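/- Consider a downlink cellular network with parameters $\lambda_{BS},\lambda_{MT},K,P,W,\gamma,\theta>0$ and $\alpha>2$. The base stations (BSs) form a homogeneous Poisson point process $\Phi_{BS}$ on $\mathbb{R}^2$ of density $\lambda_{BS}$. Mobile terminals have density $\lambda_{MT}$; their effect is modelled through the active probability $$L=1-\Bigl(1+\frac{\lambda_{MT}}{3.5\,\lambda_{BS}}\Bigr)^{-3.5}:$$ each BS is active with probability $L$, independently of the other BSs and of the locations. The typical user is at the origin. Let $r_i$ be the distance from the origin to the $i$-th BS and $\ell(r)=Kr^{\alpha}$ the path loss. The serving BS is the one that maximizes $1/\ell(r_i)$, i.e. the nearest one, at distance $r_0$; the interferers $\Phi_I$ are all active BSs other than the serving one (so that, given $r_0$, $\Phi_I$ is a Poisson process of density $\lambda_{BS}L\,\mathbf 1(r>r_0)$). Let $\Phi$ denote the locations and activities of the BSs. The power fading coefficients $h_0$ (serving link) and $h_i$ (interfering links) are i.i.d. exponential of mean $1$ and independent of $\Phi$. Put $$S=\frac{Ph_0}{\ell(r_0)},\quad I=\sum_{i\in\Phi_I}\frac{Ph_i}{\ell(r_i)},\quad \mathrm{SIR}=\frac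 SI,\quad \mathrm{SINR}=\frac S{I+W},\quad \mathrm{ASNR}=\frac P{W\ell(r_0)}.$$ The conditional coverage probability $P_{cov}^{\Phi}$ is the conditional probability given $\Phi$ (that is, over the fading only) of the event $\{\mathrm{SIR}>\gamma\}$ for the SIR-based criterion, $\{\mathrm{SINR}>\gamma\}$ for the SINR-based criterion, and $\{\mathrm{SIR}>\gamma,\ \mathrm{ASNR}>\theta\}$ for the SIR+ASNR-based criterion. The local delay is $D=\mathbb{E}_{\Phi}\bigl[1/P_{cov}^{\Phi}\bigr]\in[0,\infty]$, with $1/0=\infty$. Correspondingly, let $\mathcal G(r_0)=1$ for SIR, $\mathcal G(r_0)=e^{-\gamma WKr_0^{\alpha}/P}$ for SINR, and $\mathcal G(r_0)=\mathbf 1\bigl(r_0\le (P/(KW\theta))^{1/\alpha}\bigr)$ for SIR+ASNR. **Theorem.** For each of the three coverage criteria, the random variable $1/P_{cov}^{\Phi}$ is (a.e.) measurable and $$D=2\pi\lambda_{BS}\int_0^\infty \frac{r_0\,\exp\Bigl(-\pi\lambda_{BS}r_0^2\bigl(1-\tfrac{2\gamma L}{\alpha-2}\bigr)\Bigr)}{\mathcal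 G(r_0)}\,dr_0,$$ as an equality in $[0,\infty]$, where the integrand is $+\infty$ at every $r_0>0$ with $\mathcal G(r_0)=0$. -/

import Mathlib

open MeasureTheory ProbabilityTheory Set
open scoped ENNReal NNReal

noncomputable section

/-- The Euclidean plane in which base stations and mobile terminals live. The typical user is
located at the origin. -/
abbrev Plane : Type := EuclideanSpace ℝ (Fin 2)

/-- The parameters of the downlink cellular network. -/
structure NetworkParams where
  /-- density of the base stations -/
  lamBS : ℝ
  /-- density of the mobile terminals -/
  lamMT : ℝ
  /-- path-loss constant -/
  K : ℝ
  /-- path-loss exponent -/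
  α : ℝ
  /-- transmit power -/
  P : ℝ
  /-- noise power -/
  W : ℝ
  /-- decoding threshold -/
  γ : ℝ
  /-- detection threshold -/
  θ : ℝ
  lamBS_pos : 0 < lamBS
  lamMT_pos : 0 < lamMT
  K_pos : 0 < K
  two_lt_α : 2 < α
  P_pos : 0 < P
  W_pos : 0 < W
  γ_pos : 0 < γ
  θ_pos : 0 < θ

/-- The three coverage criteria. -/
inductive CoverageCriterion where
  | sir
  | sinr
  | sirAsnr

/-- The number of indices `n` such that the point `x n` lies in `B`. -/
def pointCount (x : ℕ → Plane) (B : Set Plane) : ℕ∞ :=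
  {n : ℕ | x n ∈ B}.encard

/-- The random points `X 0, X 1, X 2, …` enumerate a homogeneous Poisson point process of
intensity `lam` on the plane: the number of points in a bounded Borel set `B` is Poisson with mean
`lam * |B|`, and the numbers of points in finitely many pairwise disjoint bounded Borel sets are
independent. (For `lam > 0` such a process has infinitely many points, almost surely
distinct.) -/
structure IsHomogeneousPPP {Ω : Type*} [MeasurableSpace Ω] (μ : Measure Ω) (lam : ℝ≥0)
    (X : ℕ → Ω → Plane) : Prop where
  measurable : ∀ n, Measurable (X n)
  count_law : ∀ B : Set Plane, MeasurableSet B → Bornology.IsBounded B →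
    HasLaw (fun ω => pointCount (fun n => X n ω) B)
      ((poissonMeasure (lam * (volume B).toNNReal)).map (fun k : ℕ => (k : ℕ∞))) μ
  count_indep : ∀ (k : ℕ) (B : Fin k → Set Plane),
    (∀ j, MeasurableSet (B j)) → (∀ j, Bornology.IsBounded (B j)) →
    Pairwise (Function.onFun Disjoint B) →
    iIndepFun (fun (j : Fin k) (ω : Ω) => pointCount (fun n => X n ω) (B j)) μ

namespace NetworkParams

/-- The active probability of a base station,
`L = 1 - (1 + λ_MT / (3.5 λ_BS)) ^ (-3.5)`. -/
def activeProb (p : NetworkParams) : ℝ :=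
  1 - (1 + p.lamMT / ((7 / 2) * p.lamBS)) ^ (-(7 / 2) : ℝ)

/-- The path loss `ℓ(r) = K r ^ α`; the power received at distance `r` is the transmitted power
divided by `ℓ(r)`. -/
def pathLoss (p : NetworkParams) (r : ℝ) : ℝ≥0∞ :=
  ENNReal.ofReal (p.K * r ^ p.α)

/-- A random network realization. The base stations `X n` enumerate a homogeneous Poisson point
process of density `λ_BS`. The base station `X n` is active when `act n = true`; the
activities are i.i.d. Bernoulli with parameter the active probability `L`, and independent of
the locations. -/
structure IsNetwork (p : NetworkParams) {Ω : Type*} [MeasurableSpace Ω] (μ : Measure Ω)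
    (X : ℕ → Ω → Plane) (act : ℕ → Ω → Bool) : Prop where
  isPPP : IsHomogeneousPPP μ p.lamBS.toNNReal X
  measurable_act : ∀ n, Measurable (act n)
  prob_act : ∀ n, μ {ω | act n ω = true} = ENNReal.ofReal p.activeProb
  iIndep_act : iIndepFun act μ
  indep_act : IndepFun (fun ω n => X n ω) (fun ω n => act n ω) μ

/-- The index of the serving base station `BS₀` of the typical user: the argument of the maximum
of `1 / ℓ(r_n)` over all base stations, where `r_n = ‖x n‖`. The maximizer is almost surely unique
for a Poisson process; ties are broken by the smallest index. -/
def servingIndex (p : NetworkParams) (x : ℕ → Plane) : ℕ :=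
  sInf {n : ℕ | ∀ m : ℕ, (p.pathLoss ‖x m‖)⁻¹ ≤ (p.pathLoss ‖x n‖)⁻¹}

/-- The power received by the typical user from the `n`-th base station, `P h_n / ℓ(r_n)`. -/
def receivedPower (p : NetworkParams) (x : ℕ → Plane) (h : ℕ → ℝ) (n : ℕ) : ℝ≥0∞ :=
  ENNReal.ofReal (p.P * h n) / p.pathLoss ‖x n‖

/-- The useful signal `S`, received from the serving base station. -/
def signal (p : NetworkParams) (x : ℕ → Plane) (h : ℕ → ℝ) : ℝ≥0∞ :=
  p.receivedPower x h (p.servingIndex x)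

/-- The set `Φ_I` of (indices of) interfering base stations: all active base stations other than
the serving one. -/
def interferers (p : NetworkParams) (x : ℕ → Plane) (act : ℕ → Bool) : Set ℕ :=
  {n : ℕ | act n = true ∧ n ≠ p.servingIndex x}

/-- The aggregate interference `I`. -/
def interference (p : NetworkParams) (x : ℕ → Plane) (act : ℕ → Bool) (h : ℕ → ℝ) : ℝ≥0∞ :=
  ∑' n : p.interferers x act, p.receivedPower x h n

/-- `SIR = S / I`. -/
def SIR (p : NetworkParams) (x : ℕ → Plane) (act : ℕ → Bool) (h : ℕ → ℝ) : ℝ≥0∞ :=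
  p.signal x h / p.interference x act h

/-- `SINR = S / (I + W)`. -/
def SINR (p : NetworkParams) (x : ℕ → Plane) (act : ℕ → Bool) (h : ℕ → ℝ) : ℝ≥0∞ :=
  p.signal x h / (p.interference x act h + ENNReal.ofReal p.W)

/-- `ASNR = P / (W ℓ(r₀))`. -/
def ASNR (p : NetworkParams) (x : ℕ → Plane) : ℝ≥0∞ :=
  ENNReal.ofReal p.P / (ENNReal.ofReal p.W * p.pathLoss ‖x (p.servingIndex x)‖)

/-- The event that the typical user is covered. -/
def Covered (p : NetworkParams) (c : CoverageCriterion) (x : ℕ → Plane) (act : ℕ → Bool)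
    (h : ℕ → ℝ) : Prop :=
  match c with
  | .sir => ENNReal.ofReal p.γ < p.SIR x act h
  | .sinr => ENNReal.ofReal p.γ < p.SINR x act h
  | .sirAsnr => ENNReal.ofReal p.γ < p.SIR x act h ∧ ENNReal.ofReal p.θ < p.ASNR x

/-- The law of the power fading coefficients: i.i.d. exponential of unit mean (Rayleigh
fading). -/
def fadingLaw : Measure (ℕ → ℝ) :=
  Measure.infinitePi (fun _ : ℕ => expMeasure 1)

/-- The conditional coverage probability `P_cov^Φ`: for a fixed network realization `(x, act)`,
the probability over the fading coefficients only that the typical user is covered. -/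
def condCoverageProb (p : NetworkParams) (c : CoverageCriterion) (x : ℕ → Plane)
    (act : ℕ → Bool) : ℝ≥0∞ :=
  fadingLaw {h : ℕ → ℝ | p.Covered c x act h}

/-- The local delay `D = E_Φ[1 / P_cov^Φ]`, with values in `[0, ∞]`. -/
def localDelay (p : NetworkParams) (c : CoverageCriterion) {Ω : Type*} [MeasurableSpace Ω]
    (μ : Measure Ω) (X : ℕ → Ω → Plane) (act : ℕ → Ω → Bool) : ℝ≥0∞ :=
  ∫⁻ ω, (p.condCoverageProb c (fun n => X n ω) (fun n => act n ω))⁻¹ ∂μ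

/-- The criterion-dependent factor `G(r₀)`. -/
def coverageFactor (p : NetworkParams) (c : CoverageCriterion) (r₀ : ℝ) : ℝ :=
  match c with
  | .sir => 1
  | .sinr => Real.exp (-(p.γ * p.W * p.K * r₀ ^ p.α / p.P))
  | .sirAsnr => Set.indicator (Set.Iic ((p.P / (p.K * p.W * p.θ)) ^ (1 / p.α))) 1 r₀

end NetworkParams

end

/-!
The proof has three layers: the fading, the activities and the locations of the base stations.

*Fading.* For fixed locations and activities, with a unique nearest base station at distance `r₀`,
the threshold on `SIR` or `SINR` is met exactly when the exponential variable `h₀` exceeds a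
deterministic noise term plus the sum of `γ (r₀ / rₙ) ^ α hₙ` over the interferers; the threshold
on `ASNR` is a bound on `r₀`. Taking Laplace transforms of the independent `hₙ`, the inverse of the
coverage probability is a noise factor times the product of `1 + γ (r₀ / rₙ) ^ α` over the
interferers (`NetworkParams.inv_condCoverageProb`). All products are suprema of finite products of
factors that are at least `1` (`infProd`), so the identities hold in `[0, ∞]` and need no
summability.

*Activities.* These are independent of the locations, so averaging over them replaces each factor
`1 + γ (r₀ / rₙ) ^ α` by `1 + L γ (r₀ / rₙ) ^ α` and extends the product to all base stations beyond
`r₀` (`NetworkParams.IsNetwork.lintegral_infProd_act`).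

*Locations.* The void probabilities give the law of `r₀` (`IsHomogeneousPPP.map_nearestDist`). For a
function `f` vanishing on `D`, independence of the counts in disjoint sets gives the Laplace
functional `E[1(no point in D) ∏ (1 + f)] = exp (-λ |D|) exp (λ ∫ f)`
(`IsHomogeneousPPP.lintegral_infProd`). If `r₀` is localized to a dyadic cell `[a, b)` and only the
points beyond `b` are kept, with `a` in place of `r₀` in the weights, then the product is independent
of the cell and its mean is explicit. As the cells shrink, both the truncated product and its mean
increase. The limit is the product over the points farther than `r₀`; these are all points but the
nearest one, since almost surely no two points are equidistant from the origin
(`IsHomogeneousPPP.ae_norm_ne`). Monotone convergence on both sides then yields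
`E[F(r₀) ∏ (1 + L γ (r₀ / rₙ) ^ α)] = E[F(r₀) exp (2 π λ L γ r₀ ^ 2 / (α - 2))]`
(`IsHomogeneousPPP.lintegral_infProd_strictOuterWeight`), which is the claim with `F` the inverse
of the coverage factor.
-/

/-! ### Exponential and infinite products in `[0, ∞]` -/

/-- The exponential function on `[0, ∞]`, with `exp ∞ = ∞`. -/
noncomputable def ennExp (y : ℝ≥0∞) : ℝ≥0∞ := EReal.exp (y : EReal)

@[simp] lemma ennExp_zero : ennExp 0 = 1 := by simp [ennExp]

@[simp] lemma ennExp_top : ennExp ∞ = ∞ := by simp [ennExp]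

lemma ennExp_add (x y : ℝ≥0∞) : ennExp (x + y) = ennExp x * ennExp y := by
  simp [ennExp, EReal.exp_add]

lemma ennExp_mono : Monotone ennExp := fun _ _ h =>
  EReal.exp_monotone (EReal.coe_ennreal_le_coe_ennreal_iff.2 h)

lemma ennExp_ofReal {x : ℝ} (hx : 0 ≤ x) :
    ennExp (ENNReal.ofReal x) = ENNReal.ofReal (Real.exp x) := by
  rw [ennExp, EReal.coe_ennreal_ofReal, max_eq_left hx, EReal.exp_coe]

lemma one_le_ennExp (y : ℝ≥0∞) : 1 ≤ ennExp y := by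
  simpa using ennExp_mono (zero_le (a := y))

lemma ennExp_ne_zero (y : ℝ≥0∞) : ennExp y ≠ 0 :=
  (zero_lt_one.trans_le (one_le_ennExp y)).ne'

lemma ennExp_ne_top {y : ℝ≥0∞} (hy : y ≠ ∞) : ennExp y ≠ ∞ := by
  simpa [ennExp] using hy

lemma continuous_ennExp : Continuous ennExp :=
  ENNReal.continuous_exp.comp continuous_coe_ennreal_ereal

@[fun_prop]
lemma measurable_ennExp : Measurable ennExp := ennExp_mono.measurable

lemma ennExp_iSup {f : ℕ → ℝ≥0∞} : ennExp (⨆ n, f n) = ⨆ n, ennExp (f n) :=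
  ennExp_mono.map_ciSup_of_continuousAt continuous_ennExp.continuousAt (OrderTop.bddAbove _)

lemma ennExp_sum {ι : Type*} (s : Finset ι) (f : ι → ℝ≥0∞) :
    ennExp (∑ i ∈ s, f i) = ∏ i ∈ s, ennExp (f i) := by
  classical
  induction s using Finset.induction_on with
  | empty => simp
  | insert a s ha ih => rw [Finset.sum_insert ha, Finset.prod_insert ha, ennExp_add, ih]

lemma ENNReal.iSup_mul_iSup_of_monotone {f g : ℕ → ℝ≥0∞} (hf : Monotone f) (hg : Monotone g) :
    ⨆ n, f n * g n = (⨆ n, f n) * ⨆ n, g n := by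
  apply le_antisymm
  · exact iSup_le fun n => mul_le_mul' (le_iSup f n) (le_iSup g n)
  · rw [ENNReal.iSup_mul]
    refine iSup_le fun i => ?_
    rw [ENNReal.mul_iSup]
    refine iSup_le fun j => ?_
    exact (mul_le_mul' (hf (le_max_left i j)) (hg (le_max_right i j))).trans
      (le_iSup (fun n => f n * g n) (max i j))

lemma ENNReal.finsetProd_iSup_of_monotone {ι : Type*} (s : Finset ι) {f : ι → ℕ → ℝ≥0∞}
    (hf : ∀ i, Monotone (f i)) : ∏ i ∈ s, ⨆ n, f i n = ⨆ n, ∏ i ∈ s, f i n := by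
  classical
  induction s using Finset.induction_on with
  | empty => simp
  | insert a s ha ih =>
    simp_rw [Finset.prod_insert ha]
    rw [ih, ENNReal.iSup_mul_iSup_of_monotone (hf a)]
    exact fun m n h => Finset.prod_le_prod' fun i _ => hf i h

/-- The infinite product `∏ₙ (1 + f n)` of factors that are at least `1`, with values in
`[0, ∞]`. It is the supremum of the finite products, so no convergence is assumed. -/
noncomputable def infProd (f : ℕ → ℝ≥0∞) : ℝ≥0∞ := ⨆ N, ∏ n ∈ Finset.range N, (1 + f n)

lemma monotone_prod_one_add (f : ℕ → ℝ≥0∞) :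
    Monotone fun N => ∏ n ∈ Finset.range N, (1 + f n) :=
  monotone_nat_of_le_succ fun N => by
    rw [Finset.prod_range_succ]
    exact le_mul_of_one_le_right' le_self_add

lemma infProd_mono : Monotone infProd := fun _ _ h =>
  iSup_mono fun _ => Finset.prod_le_prod' fun n _ => add_le_add le_rfl (h n)

lemma one_le_infProd (f : ℕ → ℝ≥0∞) : 1 ≤ infProd f :=
  le_iSup_of_le 0 (by simp)

/-- Monotone convergence for infinite products. -/
lemma infProd_iSup_of_monotone {f : ℕ → ℕ → ℝ≥0∞} (hf : ∀ n, Monotone fun k => f k n) :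
    infProd (fun n => ⨆ k, f k n) = ⨆ k, infProd (f k) := by
  unfold infProd
  rw [iSup_comm]
  refine iSup_congr fun N => ?_
  rw [← ENNReal.finsetProd_iSup_of_monotone]
  · exact Finset.prod_congr rfl fun n _ => by rw [ENNReal.add_iSup]
  · exact fun n a b h => add_le_add le_rfl (hf n h)

lemma Measurable.infProd {Ω : Type*} [MeasurableSpace Ω] {f : ℕ → Ω → ℝ≥0∞}
    (hf : ∀ n, Measurable (f n)) : Measurable fun ω => infProd fun n => f n ω := by
  unfold _root_.infProd
  fun_prop

/-- Only finitely many factors differ from `1`: the infinite product is a finite one. -/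
lemma infProd_eq_prod {f : ℕ → ℝ≥0∞} (T : Finset ℕ) (hT : ∀ n, n ∉ T → f n = 0) :
    infProd f = ∏ n ∈ T, (1 + f n) := by
  apply le_antisymm
  · refine iSup_le fun N => ?_
    calc ∏ n ∈ Finset.range N, (1 + f n) = ∏ n ∈ Finset.range N ∩ T, (1 + f n) := by
          symm
          refine Finset.prod_subset Finset.inter_subset_left fun n hn hn' => ?_
          rw [hT n fun h => hn' (Finset.mem_inter.2 ⟨hn, h⟩), add_zero]
      _ ≤ _ := Finset.prod_le_prod_of_subset_of_one_le' Finset.inter_subset_right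
          fun _ _ _ => le_self_add
  · obtain ⟨N, hN⟩ := T.exists_nat_subset_range
    exact le_iSup_of_le N (Finset.prod_le_prod_of_subset_of_one_le' hN
      fun _ _ _ => le_self_add)

/-! ### Rayleigh fading -/

/-- The Laplace transform of the exponential law of mean `1`. -/
lemma lintegral_inv_ennExp_expMeasure {y : ℝ≥0∞} (hy : y ≠ ∞) :
    ∫⁻ t, (ennExp (y * ENNReal.ofReal t))⁻¹ ∂expMeasure 1 = (1 + y)⁻¹ := by
  lift y to ℝ≥0 using hy
  have hpos : (0 : ℝ) < 1 + y := by positivity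
  -- Up to the factor `1 + y`, the integrand is the exponential density of rate `1 + y`.
  have hpdf : ∀ t, exponentialPDF 1 t * (ennExp (y * ENNReal.ofReal t))⁻¹ =
      (1 + (y : ℝ≥0∞))⁻¹ * exponentialPDF (1 + y) t := by
    intro t
    rcases lt_or_ge t 0 with ht | ht
    · simp [exponentialPDF_of_neg ht]
    · have h1 : (1 + (y : ℝ≥0∞)) = ENNReal.ofReal (1 + y) := by
        rw [ENNReal.ofReal_add zero_le_one y.coe_nonneg]; simp
      have h2 : (y : ℝ≥0∞) * ENNReal.ofReal t = ENNReal.ofReal (y * t) := by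
        rw [ENNReal.ofReal_mul y.coe_nonneg]; simp
      rw [exponentialPDF_of_nonneg ht, exponentialPDF_of_nonneg ht, h1, h2,
        ennExp_ofReal (by positivity), ← ENNReal.ofReal_inv_of_pos (Real.exp_pos _),
        ← ENNReal.ofReal_inv_of_pos hpos, ← ENNReal.ofReal_mul (by positivity),
        ← ENNReal.ofReal_mul (by positivity), ← Real.exp_neg, mul_assoc, ← Real.exp_add,
        ← mul_assoc, inv_mul_cancel₀ hpos.ne']
      ring_nf
  have hmeas : Measurable (exponentialPDF 1) :=
    (measurable_exponentialPDFReal 1).ennreal_ofReal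
  have hmeas' : Measurable (exponentialPDF (1 + y)) :=
    (measurable_exponentialPDFReal _).ennreal_ofReal
  have : expMeasure 1 = volume.withDensity (exponentialPDF 1) := rfl
  rw [this, lintegral_withDensity_eq_lintegral_mul _ hmeas (by fun_prop)]
  simp only [Pi.mul_apply, hpdf]
  rw [lintegral_const_mul _ hmeas', lintegral_exponentialPDF_eq_one hpos, mul_one]

instance : IsProbabilityMeasure (expMeasure 1) := isProbabilityMeasure_expMeasure one_pos

lemma expMeasure_setOf_lt_ofReal (y : ℝ≥0∞) :
    expMeasure 1 {t | y < ENNReal.ofReal t} = (ennExp y)⁻¹ := by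
  rcases eq_or_ne y ∞ with rfl | hy
  · simp
  lift y to ℝ≥0 using hy
  have h : {t : ℝ | (y : ℝ≥0∞) < ENNReal.ofReal t} = (Iic (y : ℝ))ᶜ := by
    ext t
    rw [compl_Iic, mem_Ioi, mem_ofPred_eq, ← ENNReal.ofReal_coe_nnreal,
      ENNReal.ofReal_lt_ofReal_iff_of_nonneg y.coe_nonneg]
  rw [h, prob_compl_eq_one_sub measurableSet_Iic, ← ofReal_cdf, cdf_expMeasure_eq one_pos,
    if_pos y.coe_nonneg, ← ENNReal.ofReal_coe_nnreal, ennExp_ofReal y.coe_nonneg,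
    ← ENNReal.ofReal_inv_of_pos (Real.exp_pos _), ← ENNReal.ofReal_one,
    ← ENNReal.ofReal_sub _ (by simp), ← Real.exp_neg]
  ring_nf

namespace NetworkParams

instance : IsProbabilityMeasure fadingLaw := by
  unfold fadingLaw; infer_instance

lemma iIndepFun_fadingLaw : iIndepFun (fun (n : ℕ) (h : ℕ → ℝ) => h n) fadingLaw :=
  iIndepFun_infinitePi (P := fun _ : ℕ => expMeasure 1) (X := fun _ x => x) fun _ => measurable_id

lemma map_eval_fadingLaw (n : ℕ) : fadingLaw.map (fun h => h n) = expMeasure 1 :=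
  (measurePreserving_eval_infinitePi (fun _ : ℕ => expMeasure 1) n).map_eq

/-- A fading coefficient is independent of any weighted sum of the other ones. -/
lemma indepFun_fadingLaw_tsum {s : ℕ} {y : ℕ → ℝ≥0∞} (hs : y s = 0) :
    IndepFun (fun h : ℕ → ℝ => h s) (fun h => ∑' n, y n * ENNReal.ofReal (h n)) fadingLaw := by
  have key := indep_iSup_of_disjoint (fun n => (measurable_pi_apply n).comap_le)
    iIndepFun_fadingLaw.iIndep (disjoint_compl_right (a := ({s} : Set ℕ)))
  rw [IndepFun_iff_Indep]
  refine indep_of_indep_of_le_left (indep_of_indep_of_le_right key ?_) ?_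
  · rw [← measurable_iff_comap_le]
    refine @Measurable.tsum _ _ _ (_) _ _ _ _ _ _ _ _ _ _ _ _ fun n => ?_
    rcases eq_or_ne n s with rfl | hn
    · simp only [hs, zero_mul]
      exact @measurable_const _ _ _ (_) _
    · have h1 : Measurable[⨆ n ∈ ({s}ᶜ : Set ℕ), MeasurableSpace.comap (fun h : ℕ → ℝ => h n)
          inferInstance] fun h : ℕ → ℝ => h n :=
        measurable_iff_comap_le.2 (le_iSup₂_of_le n hn le_rfl)
      have h2 : Measurable fun t : ℝ => y n * ENNReal.ofReal t := by fun_prop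
      exact h2.comp h1
  · exact le_iSup₂_of_le s rfl le_rfl

lemma lintegral_prod_inv_ennExp_fadingLaw {y : ℕ → ℝ≥0∞} (hy : ∀ n, y n ≠ ∞) (N : ℕ) :
    ∫⁻ h, ∏ n ∈ Finset.range N, (ennExp (y n * ENNReal.ofReal (h n)))⁻¹ ∂fadingLaw =
      ∏ n ∈ Finset.range N, (1 + y n)⁻¹ := by
  have hind : iIndepFun (fun (n : ℕ) (h : ℕ → ℝ) => (ennExp (y n * ENNReal.ofReal (h n)))⁻¹)
      fadingLaw :=
    iIndepFun_fadingLaw.comp (fun n t => (ennExp (y n * ENNReal.ofReal t))⁻¹)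
      fun n => by fun_prop
  refine (lintegral_prod_eq_prod_lintegral_of_indepFun (Finset.range N) _ hind
    fun n => by fun_prop).trans (Finset.prod_congr rfl fun n _ => ?_)
  rw [← lintegral_inv_ennExp_expMeasure (hy n), ← map_eval_fadingLaw n,
    lintegral_map (by fun_prop) (measurable_pi_apply n)]

/-- With Rayleigh fading, the probability that the coefficient `h s` exceeds a weighted sum of the
other ones plus a constant `w`: each coefficient contributes its Laplace transform. -/
lemma fadingLaw_tsum_lt {s : ℕ} {y : ℕ → ℝ≥0∞} (hs : y s = 0) (hy : ∀ n, y n ≠ ∞) (w : ℝ≥0∞)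
    (hw : w ≠ ∞) :
    fadingLaw {h | ∑' n, y n * ENNReal.ofReal (h n) + w < ENNReal.ofReal (h s)} =
      (ennExp w * infProd y)⁻¹ := by
  have hT : Measurable fun h : ℕ → ℝ => ∑' n, y n * ENNReal.ofReal (h n) := by fun_prop
  have hmap := (indepFun_iff_map_prod_eq_prod_map_map (measurable_pi_apply s).aemeasurable
    hT.aemeasurable).1 (indepFun_fadingLaw_tsum hs)
  rw [map_eval_fadingLaw] at hmap
  have hset : MeasurableSet {q : ℝ × ℝ≥0∞ | q.2 + w < ENNReal.ofReal q.1} :=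
    measurableSet_lt (by fun_prop) (by fun_prop)
  have h1 : fadingLaw {h | ∑' n, y n * ENNReal.ofReal (h n) + w < ENNReal.ofReal (h s)} =
      ∫⁻ h, (ennExp (∑' n, y n * ENNReal.ofReal (h n) + w))⁻¹ ∂fadingLaw := by
    have h2 := Measure.map_apply (μ := fadingLaw) ((measurable_pi_apply s).prodMk hT) hset
    rw [hmap] at h2
    refine h2.symm.trans ?_
    have : IsProbabilityMeasure (fadingLaw.map fun h => ∑' n, y n * ENNReal.ofReal (h n)) :=
      Measure.isProbabilityMeasure_map hT.aemeasurable
    rw [Measure.prod_apply_symm hset]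
    simp only [preimage_ofPred_eq, expMeasure_setOf_lt_ofReal]
    rw [lintegral_map (by fun_prop) hT]
  have hmeas : ∀ n, Measurable fun h : ℕ → ℝ => (ennExp (y n * ENNReal.ofReal (h n)))⁻¹ :=
    fun n => by fun_prop
  have h3 : ∀ h : ℕ → ℝ, (ennExp (∑' n, y n * ENNReal.ofReal (h n) + w))⁻¹ =
      (ennExp w)⁻¹ * ⨅ N, ∏ n ∈ Finset.range N, (ennExp (y n * ENNReal.ofReal (h n)))⁻¹ := by
    intro h
    have hfin : ∀ n, ennExp (y n * ENNReal.ofReal (h n)) ≠ ∞ := fun n =>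
      ennExp_ne_top (ENNReal.mul_ne_top (hy n) ENNReal.ofReal_ne_top)
    rw [ennExp_add, mul_comm, ENNReal.mul_inv (Or.inl (ennExp_ne_zero _))
      (Or.inr (ennExp_ne_zero _)), ENNReal.tsum_eq_iSup_nat, ennExp_iSup, ENNReal.inv_iSup]
    congr 1
    refine iInf_congr fun N => ?_
    rw [ennExp_sum, ENNReal.prod_inv_distrib]
    exact fun i _ j _ _ => Or.inr (hfin j)
  have h4 := fun N => lintegral_prod_inv_ennExp_fadingLaw hy N
  rw [h1]
  simp_rw [h3]
  rw [lintegral_const_mul _ (by fun_prop), lintegral_iInf (fun N => by fun_prop)]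
  · simp_rw [h4]
    rw [ENNReal.mul_inv (Or.inl (ennExp_ne_zero _)) (Or.inl (ennExp_ne_top hw)), infProd,
      ENNReal.inv_iSup]
    congr 1
    refine iInf_congr fun N => ?_
    rw [ENNReal.prod_inv_distrib]
    exact fun i _ j _ _ => Or.inr (ENNReal.add_ne_top.2 ⟨ENNReal.one_ne_top, hy j⟩)
  · refine antitone_nat_of_succ_le fun N h => ?_
    rw [Finset.prod_range_succ]
    exact mul_le_of_le_one_right' (ENNReal.inv_le_one.2 (one_le_ennExp _))
  · simp

end NetworkParams

/-! ### Poisson laws -/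

/-- The probability generating function of the Poisson law. -/
lemma lintegral_pow_poissonMeasure (m v : ℝ≥0) :
    ∫⁻ k, (1 + (v : ℝ≥0∞)) ^ k ∂poissonMeasure m = ennExp (m * v) := by
  have hterm : ∀ k : ℕ, ENNReal.ofReal (Real.exp (-m) * m ^ k / k.factorial) *
      (1 + (v : ℝ≥0∞)) ^ k = ennExp (m * v) *
        ENNReal.ofReal (Real.exp (-(m * (1 + v) : ℝ≥0)) * (m * (1 + v) : ℝ≥0) ^ k /
          k.factorial) := by
    intro k
    have h1 : (1 + (v : ℝ≥0∞)) = ENNReal.ofReal (1 + v) := by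
      rw [ENNReal.ofReal_add zero_le_one v.coe_nonneg]; simp
    have h2 : (m : ℝ≥0∞) * v = ENNReal.ofReal (m * v) := by
      rw [ENNReal.ofReal_mul m.coe_nonneg]; simp
    rw [h1, h2, ennExp_ofReal (by positivity), ← ENNReal.ofReal_pow (by positivity),
      ← ENNReal.ofReal_mul (by positivity), ← ENNReal.ofReal_mul (by positivity)]
    congr 1
    have h3 : Real.exp (-m) = Real.exp (m * v) * Real.exp (-(m * (1 + v) : ℝ≥0)) := by
      rw [← Real.exp_add]; push_cast; ring_nf
    rw [h3]; push_cast; rw [mul_pow]; ring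
  have h1 : ∑' k : ℕ, ENNReal.ofReal (Real.exp (-(m * (1 + v) : ℝ≥0)) *
      (m * (1 + v) : ℝ≥0) ^ k / k.factorial) = 1 := by
    rw [← ENNReal.ofReal_tsum_of_nonneg (fun k => by positivity)
      (hasSum_one_poissonMeasure _).summable, (hasSum_one_poissonMeasure _).tsum_eq,
      ENNReal.ofReal_one]
  rw [poissonMeasure, lintegral_sum_measure]
  simp only [lintegral_smul_measure, lintegral_dirac, smul_eq_mul, hterm]
  rw [ENNReal.tsum_mul_left, h1, mul_one]

lemma poissonMeasure_setOf_eq_zero (m : ℝ≥0) : poissonMeasure m {k | k = 0} = (ennExp m)⁻¹ := by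
  have : {k : ℕ | k = 0} = {0} := by ext; simp
  rw [this, poissonMeasure_singleton, ← ENNReal.ofReal_coe_nnreal, ennExp_ofReal m.coe_nonneg,
    ← ENNReal.ofReal_inv_of_pos (Real.exp_pos _), ← Real.exp_neg]
  simp

/-- Two or more points are unlikely: the probability is quadratic in the mean. -/
lemma poissonMeasure_setOf_two_le (m : ℝ≥0) : poissonMeasure m {k | 2 ≤ k} ≤ (m : ℝ≥0∞) ^ 2 := by
  have hc : {k : ℕ | 2 ≤ k} = (({0, 1} : Finset ℕ) : Set ℕ)ᶜ := by
    ext k; simp; omega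
  have hm : (0 : ℝ) ≤ m := m.coe_nonneg
  rw [hc, prob_compl_eq_one_sub (Finset.measurableSet _), ← sum_measure_singleton,
    Finset.sum_pair zero_ne_one, poissonMeasure_singleton, poissonMeasure_singleton,
    ← ENNReal.ofReal_add (by positivity) (by positivity), ← ENNReal.ofReal_one,
    ← ENNReal.ofReal_sub _ (by positivity), ← ENNReal.ofReal_coe_nnreal,
    ← ENNReal.ofReal_pow hm]
  refine ENNReal.ofReal_le_ofReal ?_
  have h := Real.add_one_le_exp (-(m : ℝ))
  simp only [pow_zero, mul_one, Nat.factorial, Nat.cast_one, div_one, pow_one]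
  nlinarith

/-! ### Poisson point processes -/

lemma measurable_pointCount {Ω : Type*} [MeasurableSpace Ω] {X : ℕ → Ω → Plane}
    (hX : ∀ n, Measurable (X n)) {B : Set Plane} (hB : MeasurableSet B) :
    Measurable fun ω => pointCount (fun n => X n ω) B :=
  measurable_encard.comp (measurable_set_iff.2 fun n => measurableSet_setOfPred.1 (hX n hB))

namespace IsHomogeneousPPP

variable {Ω : Type*} [MeasurableSpace Ω] {μ : Measure Ω} {lam : ℝ≥0} {X : ℕ → Ω → Plane}

lemma lintegral_pointCount (h : IsHomogeneousPPP μ lam X) {B : Set Plane} (hB : MeasurableSet B)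
    (hb : Bornology.IsBounded B) (φ : ℕ∞ → ℝ≥0∞) :
    ∫⁻ ω, φ (pointCount (fun n => X n ω) B) ∂μ =
      ∫⁻ k : ℕ, φ k ∂poissonMeasure (lam * (volume B).toNNReal) := by
  have hl := h.count_law B hB hb
  rw [← lintegral_map (f := φ) .of_discrete (measurable_pointCount h.measurable hB), hl.map_eq,
    lintegral_map .of_discrete .of_discrete]

lemma measure_pointCount (h : IsHomogeneousPPP μ lam X) {B : Set Plane} (hB : MeasurableSet B)
    (hb : Bornology.IsBounded B) (p : ℕ∞ → Prop) :
    μ {ω | p (pointCount (fun n => X n ω) B)} =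
      poissonMeasure (lam * (volume B).toNNReal) {k : ℕ | p k} := by
  rw [(h.count_law B hB hb).measure_eq .of_discrete, Measure.map_apply .of_discrete .of_discrete]
  rfl

lemma coe_mean (lam : ℝ≥0) {B : Set Plane} (hb : Bornology.IsBounded B) :
    ((lam * (volume B).toNNReal : ℝ≥0) : ℝ≥0∞) = lam * volume B := by
  rw [ENNReal.coe_mul, ENNReal.coe_toNNReal hb.measure_lt_top.ne]

/-- The void probabilities. -/
lemma measure_pointCount_eq_zero (h : IsHomogeneousPPP μ lam X) {B : Set Plane}
    (hB : MeasurableSet B) (hb : Bornology.IsBounded B) :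
    μ {ω | pointCount (fun n => X n ω) B = 0} = (ennExp (lam * volume B))⁻¹ := by
  rw [h.measure_pointCount hB hb (· = 0), ← coe_mean lam hb, ← poissonMeasure_setOf_eq_zero]
  simp

lemma measure_two_le_pointCount (h : IsHomogeneousPPP μ lam X) {B : Set Plane}
    (hB : MeasurableSet B) (hb : Bornology.IsBounded B) :
    μ {ω | 2 ≤ pointCount (fun n => X n ω) B} ≤ (lam * volume B) ^ 2 := by
  rw [h.measure_pointCount hB hb (2 ≤ ·), ← coe_mean lam hb]
  refine le_trans (le_of_eq ?_) (poissonMeasure_setOf_two_le _)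
  congr 1
  ext k
  exact Nat.ofNat_le_cast (α := ℕ∞)

/-- Almost surely the points are locally finite. -/
lemma ae_finite (h : IsHomogeneousPPP μ lam X) :
    ∀ᵐ ω ∂μ, ∀ R : ℕ, {n | X n ω ∈ Metric.ball (0 : Plane) R}.Finite := by
  rw [ae_all_iff]
  intro R
  have h0 : μ {ω | pointCount (fun n => X n ω) (Metric.ball (0 : Plane) R) = ⊤} = 0 := by
    rw [h.measure_pointCount measurableSet_ball Metric.isBounded_ball (· = ⊤)]
    simp
  rw [ae_iff]
  refine le_antisymm (le_trans (measure_mono ?_) h0.le) zero_le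
  intro ω hω
  exact Set.encard_eq_top hω

lemma iIndepFun_pointCount (h : IsHomogeneousPPP μ lam X) {ι : Type*} [Fintype ι]
    {B : ι → Set Plane} (hB : ∀ i, MeasurableSet (B i)) (hb : ∀ i, Bornology.IsBounded (B i))
    (hd : Pairwise (Function.onFun Disjoint B)) :
    iIndepFun (fun i ω => pointCount (fun n => X n ω) (B i)) μ := by
  let e := Fintype.equivFin ι
  have := h.count_indep _ (fun j => B (e.symm j)) (fun j => hB _) (fun j => hb _)
    fun i j hij => hd (e.symm.injective.ne hij)
  simpa using this.precomp e.injective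

/-- A product over the points of a process of a factor that depends on the location only through
finitely many values is a product of powers of these values. -/
lemma infProd_simpleFunc {x : ℕ → Plane} {g : SimpleFunc Plane ℝ≥0∞}
    (hfin : {n | g (x n) ≠ 0}.Finite) :
    infProd (fun n => g (x n)) =
      ∏ v ∈ g.range.filter (· ≠ 0), (1 + v) ^ (pointCount x (g ⁻¹' {v})).toNat := by
  classical
  rw [infProd_eq_prod hfin.toFinset (by simp),
    ← Finset.prod_fiberwise_of_maps_to (t := g.range.filter (· ≠ 0)) (g := fun n => g (x n))]
  · refine Finset.prod_congr rfl fun v hv => ?_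
    have hv0 : v ≠ 0 := (Finset.mem_filter.1 hv).2
    rw [Finset.prod_congr rfl fun n hn => by rw [(Finset.mem_filter.1 hn).2], Finset.prod_const]
    congr 1
    have : {n | x n ∈ g ⁻¹' {v}} = (hfin.toFinset.filter fun n => g (x n) = v : Finset ℕ) := by
      ext n
      simp only [mem_preimage, mem_singleton_iff, mem_ofPred_eq, Finset.coe_filter,
        Finite.mem_toFinset]
      exact ⟨fun hn => ⟨hn ▸ hv0, hn⟩, fun hn => hn.2⟩
    rw [pointCount, this, Set.encard_coe_eq_coe_finsetCard, ENat.toNat_natCast]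
  · intro n hn
    simpa using hn

/-- The Laplace functional for simple functions, restricted to the event that there is no point in
a set `D` on which the function vanishes. -/
lemma lintegral_infProd_simpleFunc (h : IsHomogeneousPPP μ lam X) {D : Set Plane}
    (hD : MeasurableSet D) (hDb : Bornology.IsBounded D) {g : SimpleFunc Plane ℝ≥0∞} {R : ℕ}
    (hgD : ∀ x ∈ D, g x = 0) (hgR : ∀ x, x ∉ Metric.ball (0 : Plane) R → g x = 0)
    (hg : ∀ x, g x ≠ ∞) :
    ∫⁻ ω, (if pointCount (fun n => X n ω) D = 0 then 1 else 0) * infProd (fun n => g (X n ω)) ∂μ =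
      (ennExp (lam * volume D))⁻¹ * ennExp (lam * ∫⁻ x, g x) := by
  classical
  let V : Finset ℝ≥0∞ := g.range.filter (· ≠ 0)
  have hV : ∀ v ∈ V, v ≠ ∞ ∧ v ≠ 0 := by
    intro v hv
    obtain ⟨hv1, hv2⟩ := Finset.mem_filter.1 hv
    obtain ⟨x, rfl⟩ := SimpleFunc.mem_range.1 hv1
    exact ⟨hg x, hv2⟩
  -- The index `none` stands for `D`, the index `v` for the level set of the value `v`.
  let B : Option V → Set Plane := fun i => i.elim D fun v => g ⁻¹' {v.1}
  let φ : Option V → ℕ∞ → ℝ≥0∞ := fun i =>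
    i.elim (fun k => if k = 0 then 1 else 0) fun v k => (1 + v.1) ^ k.toNat
  have hBm : ∀ i, MeasurableSet (B i) := by
    rintro (_ | v)
    · exact hD
    · exact g.measurableSet_preimage _
  have hBb : ∀ i, Bornology.IsBounded (B i) := by
    rintro (_ | v)
    · exact hDb
    · refine (Metric.isBounded_ball (x := (0 : Plane)) (r := R)).subset fun x hx => ?_
      by_contra hc
      exact (hV v v.2).2 (by rw [← hgR x hc]; exact hx.symm)
  have hBd : Pairwise (Function.onFun Disjoint B) := by
    rintro (_ | v) (_ | w) hvw
    · exact absurd rfl hvw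
    · refine Set.disjoint_left.2 fun x hx hx' => (hV w w.2).2 ?_
      rw [← hgD x hx]; exact hx'.symm
    · refine Set.disjoint_left.2 fun x hx' hx => (hV v v.2).2 ?_
      rw [← hgD x hx]; exact hx'.symm
    · refine Set.disjoint_left.2 fun x hx hx' => hvw ?_
      exact congrArg some (Subtype.ext (hx.symm.trans hx'))
  have hind := (h.iIndepFun_pointCount hBm hBb hBd).comp φ fun i => .of_discrete
  have hprod := lintegral_prod_eq_prod_lintegral_of_indepFun Finset.univ _ hind
    fun i => (Measurable.of_discrete (f := φ i)).comp (measurable_pointCount h.measurable (hBm i))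
  have hae : ∀ᵐ ω ∂μ, (if pointCount (fun n => X n ω) D = 0 then 1 else 0) *
      infProd (fun n => g (X n ω)) = ∏ i, φ i (pointCount (fun n => X n ω) (B i)) := by
    filter_upwards [h.ae_finite] with ω hω
    have hfin : {n | g (X n ω) ≠ 0}.Finite := (hω R).subset fun n hn => by
      by_contra hc
      exact hn (hgR _ hc)
    rw [infProd_simpleFunc hfin, Fintype.prod_option, ← Finset.prod_coe_sort]
    rfl
  have hzero : ∫⁻ ω, φ none (pointCount (fun n => X n ω) (B none)) ∂μ =
      (ennExp (lam * volume D))⁻¹ := by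
    rw [← h.measure_pointCount_eq_zero hD hDb, ← lintegral_indicator_one]
    · refine lintegral_congr fun ω => ?_
      simp [φ, B, indicator_apply]
    · exact measurable_pointCount h.measurable hD (measurableSet_singleton 0)
  have hpow : ∀ v : V, ∫⁻ ω, φ (some v) (pointCount (fun n => X n ω) (B (some v))) ∂μ =
      ennExp (lam * (v.1 * volume (g ⁻¹' {v.1}))) := by
    intro v
    rw [h.lintegral_pointCount (hBm _) (hBb _)]
    obtain ⟨v, hv⟩ := v
    lift v to ℝ≥0 using (hV v hv).1
    simp only [φ, B, Option.elim, ENat.toNat_natCast]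
    rw [lintegral_pow_poissonMeasure, coe_mean lam (B := g ⁻¹' {(v : ℝ≥0∞)})
      (hBb (some ⟨v, hv⟩)), mul_assoc, mul_comm (volume _)]
  rw [lintegral_congr_ae hae]
  refine hprod.trans ?_
  rw [Fintype.prod_option]
  simp only [Function.comp_apply]
  rw [hzero, Finset.prod_congr rfl fun v _ => hpow v, ← ennExp_sum, ← Finset.mul_sum,
    Finset.sum_coe_sort V fun v => v * volume (g ⁻¹' {v}), g.lintegral_eq_lintegral,
    SimpleFunc.lintegral, Finset.sum_filter_of_ne]
  intro v _ hv
  exact left_ne_zero_of_mul hv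

/-- The Laplace functional of a Poisson process, restricted to the event that there is no point in
a set `D` on which the function vanishes. -/
lemma lintegral_infProd (h : IsHomogeneousPPP μ lam X) {D : Set Plane}
    (hD : MeasurableSet D) (hDb : Bornology.IsBounded D) {f : Plane → ℝ≥0∞} (hf : Measurable f)
    (hfD : ∀ x ∈ D, f x = 0) :
    ∫⁻ ω, (if pointCount (fun n => X n ω) D = 0 then 1 else 0) * infProd (fun n => f (X n ω)) ∂μ =
      (ennExp (lam * volume D))⁻¹ * ennExp (lam * ∫⁻ x, f x) := by
  -- Restricting to balls gives the simple functions bounded support.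
  let g : ℕ → SimpleFunc Plane ℝ≥0∞ := fun k =>
    (SimpleFunc.eapprox f k).restrict (Metric.ball 0 k)
  have hg : ∀ k x, g k x = (Metric.ball (0 : Plane) k).indicator (SimpleFunc.eapprox f k) x :=
    fun k x => SimpleFunc.restrict_apply _ measurableSet_ball x
  have hmono : ∀ x, Monotone fun k => g k x := by
    intro x k l hkl
    simp only [hg]
    refine (indicator_le_indicator (SimpleFunc.monotone_eapprox f hkl x)).trans ?_
    exact indicator_le_indicator_of_subset (Metric.ball_subset_ball (by exact_mod_cast hkl))
      (fun _ => zero_le) x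
  have hsup : ∀ x, ⨆ k, g k x = f x := by
    intro x
    refine le_antisymm (iSup_le fun k => ?_) ?_
    · rw [hg, ← SimpleFunc.iSup_eapprox_apply hf x]
      exact (indicator_le_self _ _ x).trans (le_iSup (fun k => SimpleFunc.eapprox f k x) k)
    · rw [← SimpleFunc.iSup_eapprox_apply hf x]
      refine iSup_le fun k => ?_
      obtain ⟨l, hl⟩ := exists_nat_gt ‖x‖
      refine le_trans ?_ (le_iSup (fun k => g k x) (max k l))
      rw [hg, indicator_of_mem]
      · exact SimpleFunc.monotone_eapprox f (le_max_left k l) x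
      · rw [mem_ball_zero_iff]
        exact hl.trans_le (by exact_mod_cast le_max_right k l)
  have hgle : ∀ k x, g k x ≤ f x := fun k x => by
    rw [← hsup x]; exact le_iSup (fun k => g k x) k
  have hcount : Measurable fun ω => if pointCount (fun n => X n ω) D = 0 then (1 : ℝ≥0∞) else 0 :=
    (Measurable.of_discrete (f := fun k : ℕ∞ => if k = 0 then (1 : ℝ≥0∞) else 0)).comp
      (measurable_pointCount h.measurable hD)
  have hX := h.measurable
  simp_rw [← hsup]
  simp_rw [infProd_iSup_of_monotone fun n => hmono (X n _), ENNReal.mul_iSup]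
  rw [lintegral_iSup, lintegral_iSup, ENNReal.mul_iSup, ennExp_iSup, ENNReal.mul_iSup]
  · refine iSup_congr fun k => ?_
    refine h.lintegral_infProd_simpleFunc hD hDb (R := k) ?_ ?_ ?_
    · exact fun x hx => le_antisymm ((hgle k x).trans (hfD x hx).le) zero_le
    · intro x hx
      rw [hg, indicator_of_notMem hx]
    · intro x
      rw [hg]
      exact ((indicator_le_self _ _ x).trans_lt (SimpleFunc.eapprox_lt_top f k x)).ne
  · exact fun k => (g k).measurable
  · exact fun k l hkl x => hmono x hkl
  · exact fun k => hcount.mul (Measurable.infProd fun n => (g k).measurable.comp (hX n))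
  · exact fun k l hkl ω => mul_le_mul' le_rfl (infProd_mono fun n => hmono _ hkl)

end IsHomogeneousPPP

/-! ### Radial integrals -/

/-- The expected interference from outside a disc: the integral of a power law over the complement
of the ball of radius `b`. -/
lemma lintegral_rpow_norm_of_le {a b α C : ℝ} (ha : 0 ≤ a) (hb : 0 < b) (hα : 2 < α)
    (hC : 0 ≤ C) :
    ∫⁻ x : Plane, (if b ≤ ‖x‖ then ENNReal.ofReal (C * (a / ‖x‖) ^ α) else 0) =
      ENNReal.ofReal (2 * Real.pi * C * a ^ α * b ^ (2 - α) / (α - 2)) := by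
  let F : ℝ → ℝ := (Ici b).indicator fun r => C * (a / r) ^ α
  have hF0 : ∀ r, 0 ≤ F r := fun r => indicator_nonneg (fun r hr => by
    have : 0 ≤ r := hb.le.trans hr
    positivity) r
  have hyF : ∀ y ∈ Ioi (0 : ℝ), y ^ (2 - 1) • F y =
      (Ici b).indicator (fun r => C * a ^ α * r ^ (1 - α)) y := by
    intro y hy
    have hy : 0 < y := hy
    by_cases h : y ∈ Ici b
    · simp only [F, indicator_of_mem h, smul_eq_mul]
      rw [Real.div_rpow ha hy.le, Real.rpow_sub hy, Real.rpow_one]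
      ring
    · simp [F, indicator_of_notMem h]
  have hsub : Ici b ⊆ Ioi (0 : ℝ) := fun r hr => hb.trans_le hr
  have hint : IntegrableOn (fun y : ℝ => y ^ (2 - 1) • F y) (Ioi 0) := by
    refine IntegrableOn.congr_fun (f := (Ici b).indicator fun r => C * a ^ α * r ^ (1 - α)) ?_
      (fun y hy => (hyF y hy).symm) measurableSet_Ioi
    rw [IntegrableOn, integrable_indicator_iff measurableSet_Ici, IntegrableOn,
      Measure.restrict_restrict measurableSet_Ici, inter_eq_left.2 hsub,
      ← IntegrableOn, integrableOn_Ici_iff_integrableOn_Ioi]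
    exact (integrableOn_Ioi_rpow_of_lt (by linarith) hb).const_mul _
  have hrank : Module.finrank ℝ Plane = 2 := by simp
  have hI : Integrable (fun x : Plane => F ‖x‖) := by
    rw [integrable_fun_norm_addHaar, hrank]
    exact hint
  have hval : ∫ x : Plane, F ‖x‖ = 2 * Real.pi * C * a ^ α * b ^ (2 - α) / (α - 2) := by
    rw [integral_fun_norm_addHaar, hrank, setIntegral_congr_fun measurableSet_Ioi hyF,
      setIntegral_indicator measurableSet_Ici, inter_eq_right.2 hsub, integral_Ici_eq_integral_Ioi,
      integral_const_mul, integral_Ioi_rpow_of_lt (by linarith) hb, measureReal_def,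
      EuclideanSpace.volume_ball_fin_two]
    have h1 : 1 - α + 1 = 2 - α := by ring
    have h2 : α - 2 ≠ 0 := by linarith
    have h3 : 2 - α ≠ 0 := by linarith
    simp only [ENNReal.ofReal_one, one_pow, one_mul, nsmul_eq_mul, smul_eq_mul, h1,
      ENNReal.toReal_ofReal Real.pi_pos.le]
    push_cast
    field_simp
    ring
  rw [← hval, ofReal_integral_eq_lintegral_ofReal hI (Filter.Eventually.of_forall fun x => hF0 _)]
  refine lintegral_congr fun x => ?_
  by_cases h : b ≤ ‖x‖
  · simp only [F, if_pos h, indicator_of_mem (show ‖x‖ ∈ Ici b from h)]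
  · simp only [F, if_neg h, indicator_of_notMem (show ‖x‖ ∉ Ici b from h), ENNReal.ofReal_zero]

lemma volume_ball_zero_plane {r : ℝ} (hr : 0 ≤ r) :
    volume (Metric.ball (0 : Plane) r) = ENNReal.ofReal (Real.pi * r ^ 2) := by
  rw [EuclideanSpace.volume_ball_fin_two, ← ENNReal.ofReal_pow hr,
    ← ENNReal.ofReal_mul (by positivity), mul_comm]

/-- The law of the distance from the origin to the nearest point of a Poisson process of intensity
`lam`: a Rayleigh law. -/
noncomputable def nearestDistLaw (lam : ℝ) : Measure ℝ :=
  (volume.restrict (Ioi 0)).withDensity fun r =>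
    ENNReal.ofReal (2 * Real.pi * lam * r * Real.exp (-(Real.pi * lam * r ^ 2)))

lemma nearestDistLaw_Ici {lam : ℝ} (hlam : 0 < lam) (a : ℝ) :
    nearestDistLaw lam (Ici a) = ENNReal.ofReal (Real.exp (-(Real.pi * lam * max a 0 ^ 2))) := by
  have hpi := Real.pi_pos
  set g : ℝ → ℝ := fun r => -Real.exp (-(Real.pi * lam * r ^ 2)) with hg
  set g' : ℝ → ℝ := fun r => 2 * Real.pi * lam * r * Real.exp (-(Real.pi * lam * r ^ 2)) with hg'
  have hderiv : ∀ r ∈ Ici (max a 0), HasDerivAt g (g' r) r := by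
    intro r _
    have h1 : HasDerivAt (fun r : ℝ => -(Real.pi * lam * r ^ 2)) (-(Real.pi * lam * (2 * r))) r := by
      simpa using ((hasDerivAt_pow 2 r).const_mul (Real.pi * lam)).fun_neg
    convert! h1.exp.fun_neg using 1
    simp only [hg']
    ring
  have hpos : ∀ r ∈ Ioi (max a 0), 0 ≤ g' r := by
    intro r hr
    have : 0 ≤ r := (le_max_right a 0).trans hr.out.le
    simp only [hg']
    positivity
  have hlim : Filter.Tendsto g Filter.atTop (nhds 0) := by
    have h1 : Filter.Tendsto (fun r : ℝ => Real.pi * lam * r ^ 2) Filter.atTop Filter.atTop :=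
      (Filter.tendsto_pow_atTop two_ne_zero).const_mul_atTop (by positivity)
    simpa [hg] using (Real.tendsto_exp_neg_atTop_nhds_zero.comp h1).neg
  have hset : (Ici a ∩ Ioi 0 : Set ℝ) =ᵐ[volume] Ioi (max a 0) := by
    rw [← Ioi_inter_Ioi]
    exact Ioi_ae_eq_Ici.symm.inter (Filter.EventuallyEq.refl _ _)
  rw [nearestDistLaw, withDensity_apply _ measurableSet_Ici,
    Measure.restrict_restrict measurableSet_Ici, Measure.restrict_congr_set hset,
    ← ofReal_integral_eq_lintegral_ofReal (integrableOn_Ioi_deriv_of_nonneg' hderiv hpos hlim)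
      ((ae_restrict_iff' measurableSet_Ioi).2 (Filter.Eventually.of_forall hpos)),
    integral_Ioi_of_hasDerivAt_of_nonneg' hderiv hpos hlim]
  simp [hg]

lemma ae_nearestDistLaw_ne (lam b : ℝ) : ∀ᵐ r ∂nearestDistLaw lam, r ≠ b := by
  refine (withDensity_absolutelyContinuous _ _).ae_le ?_
  exact ae_restrict_of_ae (Measure.ae_ne volume b)

lemma ae_nearestDistLaw_pos (lam : ℝ) : ∀ᵐ r ∂nearestDistLaw lam, 0 < r :=
  (withDensity_absolutelyContinuous _ _).ae_le (ae_restrict_mem measurableSet_Ioi)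

/-! ### The nearest point -/

/-- The distance from the origin to the nearest point of a sequence (to the closure of its range,
when no point is nearest). -/
noncomputable def nearestDist (x : ℕ → Plane) : ℝ := ⨅ n, ‖x n‖

lemma le_nearestDist_iff {x : ℕ → Plane} {r : ℝ} : r ≤ nearestDist x ↔ ∀ n, r ≤ ‖x n‖ :=
  le_ciInf_iff ⟨0, by rintro _ ⟨n, rfl⟩; exact norm_nonneg _⟩

lemma nearestDist_le (x : ℕ → Plane) (n : ℕ) : nearestDist x ≤ ‖x n‖ :=
  le_nearestDist_iff.1 le_rfl n

lemma nearestDist_nonneg (x : ℕ → Plane) : 0 ≤ nearestDist x :=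
  le_nearestDist_iff.2 fun _ => norm_nonneg _

lemma measurable_nearestDist : Measurable nearestDist :=
  Measurable.iInf fun n => (measurable_pi_apply n).norm

lemma pointCount_eq_zero_iff {x : ℕ → Plane} {B : Set Plane} :
    pointCount x B = 0 ↔ ∀ n, x n ∉ B := by
  simp [pointCount, Set.eq_empty_iff_forall_notMem]

lemma pointCount_ball_eq_zero_iff {x : ℕ → Plane} {r : ℝ} :
    pointCount x (Metric.ball 0 r) = 0 ↔ r ≤ nearestDist x := by
  simp [pointCount_eq_zero_iff, le_nearestDist_iff]

/-- A locally finite sequence of points has a nearest point. -/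
lemma exists_norm_eq_nearestDist {x : ℕ → Plane}
    (hx : ∀ R : ℕ, {n | x n ∈ Metric.ball (0 : Plane) R}.Finite) :
    ∃ s, ‖x s‖ = nearestDist x := by
  obtain ⟨R, hR⟩ := exists_nat_gt ‖x 0‖
  obtain ⟨s, hs, hmin⟩ := Set.exists_min_image _ (fun n => ‖x n‖) (hx R) ⟨0, by simpa using hR⟩
  refine ⟨s, le_antisymm (le_nearestDist_iff.2 fun n => ?_) (nearestDist_le x s)⟩
  by_cases hn : x n ∈ Metric.ball (0 : Plane) R
  · exact hmin n hn
  · have h1 : ‖x s‖ < R := by simpa using hs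
    have h2 : (R : ℝ) ≤ ‖x n‖ := by simpa using hn
    exact h1.le.trans h2

namespace IsHomogeneousPPP

variable {Ω : Type*} [MeasurableSpace Ω] {μ : Measure Ω} {X : ℕ → Ω → Plane}

lemma map_nearestDist [IsProbabilityMeasure μ] {lam : ℝ} (hlam : 0 < lam)
    (h : IsHomogeneousPPP μ lam.toNNReal X) :
    μ.map (fun ω => nearestDist fun n => X n ω) = nearestDistLaw lam := by
  have hX := h.measurable
  have hm : Measurable fun ω => nearestDist fun n => X n ω :=
    measurable_nearestDist.comp (measurable_pi_lambda _ hX)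
  have : IsProbabilityMeasure (μ.map fun ω => nearestDist fun n => X n ω) :=
    Measure.isProbabilityMeasure_map hm.aemeasurable
  refine Measure.ext_of_Ici _ _ fun a => ?_
  have hset : (fun ω => nearestDist fun n => X n ω) ⁻¹' Ici a =
      {ω | pointCount (fun n => X n ω) (Metric.ball 0 (max a 0)) = 0} := by
    ext ω
    simp only [mem_preimage, mem_Ici, mem_ofPred_eq, pointCount_ball_eq_zero_iff, max_le_iff,
      nearestDist_nonneg, and_true]
  have hnn : (lam.toNNReal : ℝ≥0∞) = ENNReal.ofReal lam := rfl
  rw [Measure.map_apply hm measurableSet_Ici, hset, h.measure_pointCount_eq_zero measurableSet_ball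
    Metric.isBounded_ball, volume_ball_zero_plane (le_max_right a 0), nearestDistLaw_Ici hlam,
    hnn, ← ENNReal.ofReal_mul hlam.le, ennExp_ofReal (by positivity), Real.exp_neg,
    ENNReal.ofReal_inv_of_pos (Real.exp_pos _)]
  ring_nf

/-- Almost surely no two points have the same distance to the origin. For each `M`, cut the disc of
radius `√C` into annuli of area `π / M`: two equidistant points lie in a common annulus, and
the probability that one of the `C * M` annuli holds two points is of order `1 / M`. -/
lemma ae_norm_ne {lam : ℝ≥0} (h : IsHomogeneousPPP μ lam X) :
    ∀ᵐ ω ∂μ, ∀ n m, n ≠ m → ‖X n ω‖ ≠ ‖X m ω‖ := by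
  have key : ∀ C : ℕ, ∀ᵐ ω ∂μ, ∀ n m, n ≠ m → ‖X n ω‖ ^ 2 < C → ‖X n ω‖ ≠ ‖X m ω‖ := by
    intro C
    rw [ae_iff]
    set E := {ω | ¬∀ n m, n ≠ m → ‖X n ω‖ ^ 2 < C → ‖X n ω‖ ≠ ‖X m ω‖}
    let A : ℕ → ℕ → Set Plane := fun M j =>
      Metric.ball 0 (√((j + 1) / M)) \ Metric.ball 0 (√(j / M))
    have hvol : ∀ M j : ℕ, 0 < M → volume (A M j) = ENNReal.ofReal (Real.pi / M) := by
      intro M j hM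
      have hM' : (0 : ℝ) < M := by exact_mod_cast hM
      have hle : √((j : ℝ) / M) ≤ √((j + 1) / M) := Real.sqrt_le_sqrt (by gcongr; linarith)
      rw [measure_sdiff (Metric.ball_subset_ball hle) measurableSet_ball.nullMeasurableSet
        measure_ball_lt_top.ne, volume_ball_zero_plane (Real.sqrt_nonneg _),
        volume_ball_zero_plane (Real.sqrt_nonneg _), ← ENNReal.ofReal_sub _ (by positivity),
        Real.sq_sqrt (by positivity), Real.sq_sqrt (by positivity)]
      congr 1
      field_simp
      ring
    have hmem : ∀ (M : ℕ) (x : Plane), 0 < M → x ∈ A M ⌊M * ‖x‖ ^ 2⌋₊ := by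
      intro M x hM
      have hM' : (0 : ℝ) < M := by exact_mod_cast hM
      simp only [A, mem_sdiff, mem_ball_zero_iff, not_lt]
      constructor
      · rw [Real.lt_sqrt (norm_nonneg x), lt_div_iff₀ hM', mul_comm]
        exact Nat.lt_floor_add_one _
      · rw [Real.sqrt_le_left (norm_nonneg x), div_le_iff₀ hM', mul_comm]
        exact Nat.floor_le (by positivity)
    have hsub : ∀ M : ℕ, 0 < M →
        E ⊆ ⋃ j ∈ Finset.range (C * M), {ω | 2 ≤ pointCount (fun n => X n ω) (A M j)} := by
      intro M hM ω hω
      have hM' : (0 : ℝ) < M := by exact_mod_cast hM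
      simp only [E, mem_ofPred_eq, not_forall, not_not] at hω
      obtain ⟨n, m, hnm, hn, heq⟩ := hω
      simp only [mem_iUnion, Finset.mem_range, mem_ofPred_eq]
      refine ⟨⌊M * ‖X n ω‖ ^ 2⌋₊, ?_, ?_⟩
      · rw [Nat.floor_lt (by positivity)]
        push_cast
        rw [mul_comm]
        gcongr
      · have hm := hmem M (X m ω) hM
        rw [← heq] at hm
        rw [pointCount, ← Set.encard_pair hnm]
        refine Set.encard_le_encard ?_
        rintro k (rfl | rfl)
        · exact hmem M _ hM
        · exact hm
    have hbound : ∀ M : ℕ, 0 < M →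
        μ E ≤ ENNReal.ofReal (C * (lam * Real.pi) ^ 2 / M) := by
      intro M hM
      have hM' : (0 : ℝ) < M := by exact_mod_cast hM
      calc μ E ≤ ∑ j ∈ Finset.range (C * M),
            μ {ω | 2 ≤ pointCount (fun n => X n ω) (A M j)} :=
            (measure_mono (hsub M hM)).trans (measure_biUnion_finset_le _ _)
        _ ≤ ∑ j ∈ Finset.range (C * M), ENNReal.ofReal ((lam * (Real.pi / M)) ^ 2) := by
            refine Finset.sum_le_sum fun j _ => ?_
            refine (h.measure_two_le_pointCount (measurableSet_ball.diff measurableSet_ball)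
              (Metric.isBounded_ball.subset sdiff_subset)).trans_eq ?_
            rw [hvol M j hM, ENNReal.ofReal_pow (by positivity),
              ENNReal.ofReal_mul lam.coe_nonneg, ENNReal.ofReal_coe_nnreal]
        _ = ENNReal.ofReal (C * (lam * Real.pi) ^ 2 / M) := by
            rw [Finset.sum_const, Finset.card_range, nsmul_eq_mul, ← ENNReal.ofReal_natCast,
              ← ENNReal.ofReal_mul (by positivity)]
            congr 1
            push_cast
            field_simp
    have hlim : Filter.Tendsto (fun M : ℕ => ENNReal.ofReal (C * (lam * Real.pi) ^ 2 / M))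
        Filter.atTop (nhds 0) := by
      rw [← ENNReal.ofReal_zero]
      exact ENNReal.tendsto_ofReal (tendsto_const_div_atTop_nhds_zero_nat _)
    refine le_antisymm (ge_of_tendsto hlim ?_) zero_le
    filter_upwards [Filter.eventually_gt_atTop 0] with M hM using hbound M hM
  filter_upwards [ae_all_iff.2 key] with ω hω n m hnm
  obtain ⟨C, hC⟩ := exists_nat_gt (‖X n ω‖ ^ 2)
  exact hω C n m hnm hC

end IsHomogeneousPPP

/-! ### Conditional coverage probability -/

namespace NetworkParams

/-- The weight `γ (a / ‖x‖) ^ α` of an interferer at `x` relative to a serving station at distance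
`a`; points that are not farther than the serving station get weight `0`. -/
noncomputable def relInterference (p : NetworkParams) (a : ℝ) (x : Plane) : ℝ≥0∞ :=
  if a < ‖x‖ then ENNReal.ofReal (p.γ * (a / ‖x‖) ^ p.α) else 0

/-- The largest distance at which the average signal-to-noise ratio reaches `θ`. -/
noncomputable def detectionRadius (p : NetworkParams) : ℝ := (p.P / (p.K * p.W * p.θ)) ^ (1 / p.α)

/-- The factor by which the noise, as opposed to the interference, increases the inverse of the
conditional coverage probability. -/
noncomputable def noiseFactor (p : NetworkParams) (c : CoverageCriterion) (r : ℝ) : ℝ≥0∞ :=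
  match c with
  | .sir => 1
  | .sinr => ENNReal.ofReal (Real.exp (p.γ * p.W * p.K * r ^ p.α / p.P))
  | .sirAsnr => if r < p.detectionRadius then 1 else ∞

variable (p : NetworkParams)

lemma α_pos : 0 < p.α := two_pos.trans p.two_lt_α

lemma pathLoss_le_pathLoss_iff {r t : ℝ} (hr : 0 ≤ r) (ht : 0 ≤ t) :
    p.pathLoss r ≤ p.pathLoss t ↔ r ≤ t := by
  have hK := p.K_pos
  rw [pathLoss, pathLoss, ENNReal.ofReal_le_ofReal_iff (by positivity),
    mul_le_mul_iff_right₀ hK, Real.rpow_le_rpow_iff hr ht p.α_pos]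

lemma servingIndex_eq {x : ℕ → Plane} {s : ℕ} (hs : ‖x s‖ = nearestDist x)
    (hne : ∀ n m, n ≠ m → ‖x n‖ ≠ ‖x m‖) : p.servingIndex x = s := by
  have : {n : ℕ | ∀ m : ℕ, (p.pathLoss ‖x m‖)⁻¹ ≤ (p.pathLoss ‖x n‖)⁻¹} = {s} := by
    ext n
    simp only [ENNReal.inv_le_inv, pathLoss_le_pathLoss_iff p (norm_nonneg _) (norm_nonneg _),
      mem_ofPred_eq, mem_singleton_iff]
    constructor
    · intro h
      by_contra hn
      exact hne n s hn (le_antisymm (h s) (hs ▸ nearestDist_le x n))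
    · rintro rfl m
      exact hs ▸ nearestDist_le x m
  rw [servingIndex, this, csInf_singleton]

/-- The probability over the fading that the signal exceeds `γ` times the interference plus a
deterministic noise level `w`. -/
lemma fadingLaw_mul_interference_lt {x : ℕ → Plane} (act : ℕ → Bool) {s : ℕ}
    (hpos : ∀ n, 0 < ‖x n‖) (hs : ‖x s‖ = nearestDist x)
    (hne : ∀ n m, n ≠ m → ‖x n‖ ≠ ‖x m‖) {w : ℝ} (hw : 0 ≤ w) :
    fadingLaw {h | ENNReal.ofReal p.γ * (p.interference x act h + ENNReal.ofReal w) <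
        p.signal x h} =
      (ENNReal.ofReal (Real.exp (p.γ * w * p.K * nearestDist x ^ p.α / p.P)) *
        infProd fun n => if act n then p.relInterference (nearestDist x) (x n) else 0)⁻¹ := by
  have hγ := p.γ_pos
  have hP := p.P_pos
  have hK := p.K_pos
  have hr0 : 0 < nearestDist x := hs ▸ hpos s
  have hserv := p.servingIndex_eq hs hne
  -- Multiplying by `κ` normalizes the coefficient of `h s` in the signal to `1`.
  set κ : ℝ≥0∞ := ENNReal.ofReal (p.K * nearestDist x ^ p.α / p.P) with hκ
  have hκ0 : κ ≠ 0 := by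
    have : 0 < p.K * nearestDist x ^ p.α / p.P := by positivity
    simpa [κ] using this
  have hκt : κ ≠ ∞ := ENNReal.ofReal_ne_top
  set y : ℕ → ℝ≥0∞ :=
    fun n => if act n then p.relInterference (nearestDist x) (x n) else 0 with hy
  have hpow : ∀ h : ℕ → ℝ, ∀ n, p.receivedPower x h n =
      ENNReal.ofReal (p.P / (p.K * ‖x n‖ ^ p.α)) * ENNReal.ofReal (h n) := by
    intro h n
    have := hpos n
    rw [receivedPower, pathLoss, ENNReal.ofReal_mul hP.le, ENNReal.ofReal_div_of_pos (by positivity),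
      div_eq_mul_inv, div_eq_mul_inv]
    ring
  have hsig : ∀ h, κ * p.signal x h = ENNReal.ofReal (h s) := by
    intro h
    rw [signal, hserv, hpow, ← mul_assoc, hκ, ← ENNReal.ofReal_mul (by positivity), hs]
    have : p.K * nearestDist x ^ p.α / p.P * (p.P / (p.K * nearestDist x ^ p.α)) = 1 := by
      field_simp
    rw [this, ENNReal.ofReal_one, one_mul]
  have hterm : ∀ h : ℕ → ℝ, ∀ n, κ * (ENNReal.ofReal p.γ *
      (p.interferers x act).indicator (p.receivedPower x h) n) = y n * ENNReal.ofReal (h n) := by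
    intro h n
    by_cases hn : n ∈ p.interferers x act
    · have hlt : nearestDist x < ‖x n‖ :=
        lt_of_le_of_ne (nearestDist_le x n) (hs ▸ hne s n (hserv ▸ hn.2.symm))
      have := hpos n
      simp only [y, indicator_of_mem hn, hn.1, if_true, relInterference, if_pos hlt]
      rw [hpow, ← mul_assoc, ← mul_assoc, hκ, ← ENNReal.ofReal_mul (by positivity),
        ← ENNReal.ofReal_mul (by positivity), Real.div_rpow hr0.le (norm_nonneg _)]
      congr 2
      field_simp
    · rw [indicator_of_notMem hn, mul_zero, mul_zero]
      by_cases ha : act n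
      · have hns : n = s := by
          by_contra hns
          exact hn ⟨ha, hserv ▸ hns⟩
        simp [y, relInterference, hns, hs]
      · simp [y, ha]
  have hint : ∀ h, κ * (ENNReal.ofReal p.γ * (p.interference x act h + ENNReal.ofReal w)) =
      ∑' n, y n * ENNReal.ofReal (h n) +
        ENNReal.ofReal (p.γ * w * p.K * nearestDist x ^ p.α / p.P) := by
    intro h
    rw [interference, tsum_subtype, mul_add, mul_add, ← ENNReal.tsum_mul_left,
      ← ENNReal.tsum_mul_left]
    congr 1
    · exact tsum_congr (hterm h)
    · rw [hκ, ← ENNReal.ofReal_mul hγ.le, ← ENNReal.ofReal_mul (by positivity)]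
      congr 1
      ring
  have hset : {h | ENNReal.ofReal p.γ * (p.interference x act h + ENNReal.ofReal w) <
      p.signal x h} = {h | ∑' n, y n * ENNReal.ofReal (h n) +
        ENNReal.ofReal (p.γ * w * p.K * nearestDist x ^ p.α / p.P) < ENNReal.ofReal (h s)} := by
    ext h
    rw [mem_ofPred_eq, mem_ofPred_eq, ← hint, ← hsig,
      ENNReal.mul_lt_mul_iff_right hκ0 hκt]
  rw [hset, fadingLaw_tsum_lt _ _ _ ENNReal.ofReal_ne_top, ennExp_ofReal (by positivity)]
  · simp [y, relInterference, hs]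
  · intro n
    simp only [y, relInterference]
    split_ifs <;> simp

lemma lt_SIR_iff (x : ℕ → Plane) (act : ℕ → Bool) (h : ℕ → ℝ) :
    ENNReal.ofReal p.γ < p.SIR x act h ↔
      ENNReal.ofReal p.γ * (p.interference x act h + ENNReal.ofReal 0) < p.signal x h := by
  rw [SIR, ENNReal.ofReal_zero, add_zero, ENNReal.lt_div_iff_mul_lt (Or.inr ENNReal.ofReal_ne_top)
    (Or.inr (by simpa using p.γ_pos))]

lemma lt_SINR_iff (x : ℕ → Plane) (act : ℕ → Bool) (h : ℕ → ℝ) :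
    ENNReal.ofReal p.γ < p.SINR x act h ↔
      ENNReal.ofReal p.γ * (p.interference x act h + ENNReal.ofReal p.W) < p.signal x h := by
  rw [SINR, ENNReal.lt_div_iff_mul_lt (Or.inr ENNReal.ofReal_ne_top)
    (Or.inr (by simpa using p.γ_pos))]

lemma lt_ASNR_iff {x : ℕ → Plane} {s : ℕ} (hs : ‖x s‖ = nearestDist x) (hpos : 0 < ‖x s‖)
    (hne : ∀ n m, n ≠ m → ‖x n‖ ≠ ‖x m‖) :
    ENNReal.ofReal p.θ < p.ASNR x ↔ nearestDist x < p.detectionRadius := by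
  have hP := p.P_pos
  have hK := p.K_pos
  have hW := p.W_pos
  have hθ := p.θ_pos
  rw [hs] at hpos
  rw [ASNR, p.servingIndex_eq hs hne, hs, pathLoss, ← ENNReal.ofReal_mul hW.le,
    ← ENNReal.ofReal_div_of_pos (by positivity), ENNReal.ofReal_lt_ofReal_iff_of_nonneg hθ.le,
    detectionRadius, one_div, Real.lt_rpow_inv_iff_of_pos hpos.le (by positivity) p.α_pos,
    lt_div_iff₀ (by positivity), lt_div_iff₀ (by positivity)]
  ring_nf

/-- The inverse of the conditional coverage probability, for a realization with a unique nearest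
base station: noise and interferers contribute independent factors. -/
lemma inv_condCoverageProb (c : CoverageCriterion) {x : ℕ → Plane} (act : ℕ → Bool) {s : ℕ}
    (hpos : ∀ n, 0 < ‖x n‖) (hs : ‖x s‖ = nearestDist x)
    (hne : ∀ n m, n ≠ m → ‖x n‖ ≠ ‖x m‖) :
    (p.condCoverageProb c x act)⁻¹ = p.noiseFactor c (nearestDist x) *
      infProd fun n => if act n then p.relInterference (nearestDist x) (x n) else 0 := by
  have hsir := p.fadingLaw_mul_interference_lt act hpos hs hne le_rfl
  simp_rw [← p.lt_SIR_iff x act] at hsir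
  cases c with
  | sir =>
    simp only [condCoverageProb, Covered, hsir, inv_inv, noiseFactor]
    simp
  | sinr =>
    simp only [condCoverageProb, Covered, p.lt_SINR_iff, noiseFactor]
    rw [p.fadingLaw_mul_interference_lt act hpos hs hne p.W_pos.le, inv_inv]
  | sirAsnr =>
    simp only [condCoverageProb, Covered, noiseFactor, p.lt_ASNR_iff hs (hpos s) hne]
    by_cases h : nearestDist x < p.detectionRadius
    · simp [h, hsir]
    · have := one_le_infProd fun n => if act n then p.relInterference (nearestDist x) (x n) else 0
      simp [h, ENNReal.top_mul (zero_lt_one.trans_le this).ne']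

end NetworkParams

/-! ### Averaging over the activities -/

lemma NetworkParams.activeProb_nonneg (p : NetworkParams) : 0 ≤ p.activeProb := by
  have h1 := p.lamBS_pos
  have h2 := p.lamMT_pos
  have : 1 ≤ 1 + p.lamMT / ((7 / 2) * p.lamBS) := by
    have : 0 < p.lamMT / ((7 / 2) * p.lamBS) := by positivity
    linarith
  rw [activeProb, sub_nonneg]
  exact Real.rpow_le_one_of_one_le_of_nonpos this (by norm_num)

namespace NetworkParams.IsNetwork

variable {p : NetworkParams} {Ω : Type*} [MeasurableSpace Ω] {μ : Measure Ω}
  {X : ℕ → Ω → Plane} {act : ℕ → Ω → Bool}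

lemma lintegral_prod_act [IsProbabilityMeasure μ] (h : p.IsNetwork μ X act) (v : ℕ → ℝ≥0∞)
    (N : ℕ) :
    ∫⁻ ω, ∏ n ∈ Finset.range N, (1 + if act n ω then v n else 0) ∂μ =
      ∏ n ∈ Finset.range N, (1 + ENNReal.ofReal p.activeProb * v n) := by
  have hφ : ∀ n, Measurable fun b : Bool => 1 + if b then v n else 0 := fun n => .of_discrete
  refine (lintegral_prod_eq_prod_lintegral_of_indepFun (Finset.range N) _
    (h.iIndep_act.comp (fun n b => 1 + if b then v n else 0) hφ)
    fun n => (hφ n).comp (h.measurable_act n)).trans (Finset.prod_congr rfl fun n _ => ?_)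
  have hset : MeasurableSet {ω | act n ω = true} := h.measurable_act n (measurableSet_singleton true)
  have : ∀ ω, ((fun b : Bool => 1 + if b then v n else 0) ∘ act n) ω =
      1 + {ω | act n ω = true}.indicator (fun _ => v n) ω := fun ω => by
    simp [indicator_apply]
  simp_rw [this]
  rw [lintegral_add_left measurable_const, lintegral_indicator_const hset, h.prob_act n]
  simp [mul_comm]

/-- The activities are independent of the locations: averaging over them multiplies the weight of
each point by the active probability. -/
lemma lintegral_infProd_act [IsProbabilityMeasure μ] (h : p.IsNetwork μ X act)
    {G : (ℕ → Plane) → ℝ≥0∞} (hG : Measurable G) {z : ℕ → (ℕ → Plane) → ℝ≥0∞}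
    (hz : ∀ n, Measurable (z n)) :
    ∫⁻ ω, G (fun n => X n ω) * infProd (fun n => if act n ω then z n (fun n => X n ω) else 0) ∂μ =
      ∫⁻ ω, G (fun n => X n ω) *
        infProd (fun n => ENNReal.ofReal p.activeProb * z n fun n => X n ω) ∂μ := by
  have hX : Measurable fun ω n => X n ω := measurable_pi_lambda _ h.isPPP.measurable
  have hact : Measurable fun ω n => act n ω := measurable_pi_lambda _ h.measurable_act
  have hite : ∀ n, Measurable fun q : (ℕ → Plane) × (ℕ → Bool) => if q.2 n then z n q.1 else 0 :=
    fun n => Measurable.ite (measurableSet_eq_fun (by fun_prop) measurable_const)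
      ((hz n).comp measurable_fst) measurable_const
  have hF : ∀ N, Measurable fun q : (ℕ → Plane) × (ℕ → Bool) =>
      G q.1 * ∏ n ∈ Finset.range N, (1 + if q.2 n then z n q.1 else 0) := fun N =>
    (hG.comp measurable_fst).mul
      (Finset.measurable_prod _ fun n _ => measurable_const.add (hite n))
  have hprod := (indepFun_iff_map_prod_eq_prod_map_map hX.aemeasurable hact.aemeasurable).1
    h.indep_act
  have : IsProbabilityMeasure (μ.map fun ω n => X n ω) :=
    Measure.isProbabilityMeasure_map hX.aemeasurable
  have : IsProbabilityMeasure (μ.map fun ω n => act n ω) :=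
    Measure.isProbabilityMeasure_map hact.aemeasurable
  have hmono : ∀ v : ℕ → ℝ≥0∞, ∀ c : ℝ≥0∞,
      Monotone fun N => c * ∏ n ∈ Finset.range N, (1 + v n) :=
    fun v c _ _ hMN => mul_le_mul' le_rfl (monotone_prod_one_add v hMN)
  unfold infProd
  simp_rw [ENNReal.mul_iSup]
  rw [lintegral_iSup, lintegral_iSup]
  · refine iSup_congr fun N => ?_
    have h1 := lintegral_map (μ := μ) (hF N) (hX.prodMk hact)
    rw [hprod, lintegral_prod _ (hF N).aemeasurable] at h1
    refine h1.symm.trans ?_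
    have hinner : ∀ x : ℕ → Plane, ∫⁻ a, G x * ∏ n ∈ Finset.range N,
        (1 + if a n then z n x else 0) ∂(μ.map fun ω n => act n ω) =
        G x * ∏ n ∈ Finset.range N, (1 + ENNReal.ofReal p.activeProb * z n x) := by
      intro x
      have hm : Measurable fun a : ℕ → Bool =>
          G x * ∏ n ∈ Finset.range N, (1 + if a n then z n x else 0) :=
        (hF N).comp (measurable_prodMk_left (x := x))
      rw [lintegral_map hm hact, ← h.lintegral_prod_act (fun n => z n x) N,
        ← lintegral_const_mul]
      exact Finset.measurable_prod _ fun n _ => measurable_const.add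
        ((hite n).comp (measurable_const.prodMk hact))
    rw [lintegral_congr hinner, lintegral_map _ hX]
    exact hG.mul (Finset.measurable_prod _ fun n _ => measurable_const.add ((hz n).const_mul _))
  · exact fun N => (hG.comp hX).mul (Finset.measurable_prod _ fun n _ => measurable_const.add
      (((hz n).comp hX).const_mul _))
  · exact fun _ _ hMN ω => hmono _ _ hMN
  · exact fun N => (hF N).comp (hX.prodMk hact)
  · exact fun _ _ hMN ω => hmono _ _ hMN

end NetworkParams.IsNetwork

/-! ### Conditioning on the nearest point -/

/-- The largest point of the grid `2⁻ᵏ ℕ` that is at most `t`, for `0 ≤ t`. -/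
noncomputable def dyadicFloor (k : ℕ) (t : ℝ) : ℝ := (⌊t * 2 ^ k⌋₊ : ℝ) / 2 ^ k

/-- The smallest point of the grid `2⁻ᵏ ℕ` that is greater than `t`, for `0 ≤ t`. -/
noncomputable def dyadicSucc (k : ℕ) (t : ℝ) : ℝ := ((⌊t * 2 ^ k⌋₊ : ℝ) + 1) / 2 ^ k

lemma dyadicFloor_nonneg (k : ℕ) (t : ℝ) : 0 ≤ dyadicFloor k t := by
  unfold dyadicFloor; positivity

lemma dyadicSucc_pos (k : ℕ) (t : ℝ) : 0 < dyadicSucc k t := by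
  unfold dyadicSucc; positivity

lemma dyadicFloor_le (k : ℕ) {t : ℝ} (ht : 0 ≤ t) : dyadicFloor k t ≤ t := by
  rw [dyadicFloor, div_le_iff₀ (by positivity)]
  exact Nat.floor_le (by positivity)

lemma lt_dyadicSucc (k : ℕ) (t : ℝ) : t < dyadicSucc k t := by
  rw [dyadicSucc, lt_div_iff₀ (by positivity)]
  exact Nat.lt_floor_add_one _

lemma monotone_dyadicFloor {t : ℝ} (ht : 0 ≤ t) : Monotone fun k => dyadicFloor k t := by
  refine monotone_nat_of_le_succ fun k => ?_
  have h : 2 * ⌊t * 2 ^ k⌋₊ ≤ ⌊t * 2 ^ (k + 1)⌋₊ := by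
    refine Nat.le_floor ?_
    have := Nat.floor_le (show 0 ≤ t * 2 ^ k by positivity)
    push_cast
    rw [pow_succ]
    linarith
  have h' : 2 * (⌊t * 2 ^ k⌋₊ : ℝ) ≤ ⌊t * 2 ^ (k + 1)⌋₊ := by exact_mod_cast h
  rw [dyadicFloor, dyadicFloor, div_le_div_iff₀ (by positivity) (by positivity), pow_succ]
  have := mul_le_mul_of_nonneg_right h' (show (0 : ℝ) ≤ 2 ^ k by positivity)
  rw [pow_succ] at this
  linarith

lemma antitone_dyadicSucc {t : ℝ} (ht : 0 ≤ t) : Antitone fun k => dyadicSucc k t := by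
  refine antitone_nat_of_succ_le fun k => ?_
  have h : ⌊t * 2 ^ (k + 1)⌋₊ + 1 ≤ 2 * (⌊t * 2 ^ k⌋₊ + 1) := by
    rw [Nat.succ_le_iff, Nat.floor_lt (by positivity)]
    have := Nat.lt_floor_add_one (t * 2 ^ k)
    push_cast
    rw [pow_succ]
    linarith
  have h' : (⌊t * 2 ^ (k + 1)⌋₊ : ℝ) + 1 ≤ 2 * (⌊t * 2 ^ k⌋₊ + 1) := by exact_mod_cast h
  rw [dyadicSucc, dyadicSucc, div_le_div_iff₀ (by positivity) (by positivity), pow_succ]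
  have := mul_le_mul_of_nonneg_right h' (show (0 : ℝ) ≤ 2 ^ k by positivity)
  rw [pow_succ] at this
  linarith

lemma tendsto_dyadicFloor {t : ℝ} (ht : 0 ≤ t) :
    Filter.Tendsto (fun k => dyadicFloor k t) Filter.atTop (nhds t) :=
  (tendsto_nat_floor_mul_div_atTop ht).comp (tendsto_pow_atTop_atTop_of_one_lt one_lt_two)

lemma tendsto_dyadicSucc {t : ℝ} (ht : 0 ≤ t) :
    Filter.Tendsto (fun k => dyadicSucc k t) Filter.atTop (nhds t) := by
  have h : Filter.Tendsto (fun k : ℕ => ((1 : ℝ) / 2) ^ k) Filter.atTop (nhds 0) :=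
    tendsto_pow_atTop_nhds_zero_of_lt_one (by norm_num) (by norm_num)
  have := (tendsto_dyadicFloor ht).add h
  rw [add_zero] at this
  refine this.congr fun k => ?_
  rw [dyadicFloor, dyadicSucc, add_div, one_div_pow]

lemma measurable_dyadicFloor (k : ℕ) : Measurable (dyadicFloor k) := by
  unfold dyadicFloor; fun_prop

lemma measurable_dyadicSucc (k : ℕ) : Measurable (dyadicSucc k) := by
  unfold dyadicSucc; fun_prop

/-- The weight `C (a / ‖x‖) ^ α` of the points at distance at least `b`. -/
noncomputable def outerWeight (C α a b : ℝ) (x : Plane) : ℝ≥0∞ :=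
  if b ≤ ‖x‖ then ENNReal.ofReal (C * (a / ‖x‖) ^ α) else 0

/-- The weight `C (a / ‖x‖) ^ α` of the points at distance greater than `a`. -/
noncomputable def strictOuterWeight (C α a : ℝ) (x : Plane) : ℝ≥0∞ :=
  if a < ‖x‖ then ENNReal.ofReal (C * (a / ‖x‖) ^ α) else 0

/-- The mean of the product of `1 + outerWeight C α a b` over the points of a Poisson process of
intensity `lam`. -/
noncomputable def outerMean (lam C α a b : ℝ) : ℝ≥0∞ :=
  ENNReal.ofReal (Real.exp (lam * (2 * Real.pi * C * a ^ α * b ^ (2 - α) / (α - 2))))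

lemma measurable_outerWeight (C α a b : ℝ) : Measurable (outerWeight C α a b) :=
  Measurable.ite (measurableSet_le measurable_const measurable_norm) (by fun_prop) measurable_const

lemma outerWeight_mono {C α : ℝ} (hC : 0 ≤ C) (hα : 0 < α) {a a' b b' : ℝ} (ha : 0 ≤ a)
    (haa : a ≤ a') (hbb : b' ≤ b) (x : Plane) :
    outerWeight C α a b x ≤ outerWeight C α a' b' x := by
  unfold outerWeight
  by_cases h : b ≤ ‖x‖
  · rw [if_pos h, if_pos (hbb.trans h)]
    gcongr
  · rw [if_neg h]
    exact zero_le

lemma iSup_outerWeight {C α : ℝ} (hC : 0 ≤ C) (hα : 0 < α) {t : ℝ} (ht : 0 ≤ t) (x : Plane) :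
    ⨆ k, outerWeight C α (dyadicFloor k t) (dyadicSucc k t) x = strictOuterWeight C α t x := by
  have hmono : Monotone fun k => outerWeight C α (dyadicFloor k t) (dyadicSucc k t) x :=
    fun k l hkl => outerWeight_mono hC hα (dyadicFloor_nonneg k t) (monotone_dyadicFloor ht hkl)
      (antitone_dyadicSucc ht hkl) x
  refine iSup_eq_of_tendsto hmono ?_
  unfold strictOuterWeight
  by_cases h : t < ‖x‖
  · rw [if_pos h]
    have hlim : Filter.Tendsto (fun k => ENNReal.ofReal (C * (dyadicFloor k t / ‖x‖) ^ α))
        Filter.atTop (nhds (ENNReal.ofReal (C * (t / ‖x‖) ^ α))) :=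
      ENNReal.tendsto_ofReal ((((tendsto_dyadicFloor ht).div_const ‖x‖).rpow_const
        (Or.inr hα.le)).const_mul C)
    refine hlim.congr' ?_
    filter_upwards [(tendsto_dyadicSucc ht).eventually_lt_const h] with k hk
    rw [outerWeight, if_pos hk.le]
  · rw [if_neg h]
    refine tendsto_const_nhds.congr fun k => ?_
    rw [outerWeight, if_neg]
    exact fun hk => h ((lt_dyadicSucc k t).trans_le hk)

lemma monotone_outerMean {lam C α : ℝ} (hlam : 0 < lam) (hC : 0 ≤ C) (hα : 2 < α) {t : ℝ}
    (ht : 0 ≤ t) : Monotone fun k => outerMean lam C α (dyadicFloor k t) (dyadicSucc k t) := by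
  intro k l hkl
  have h1 := monotone_dyadicFloor ht hkl
  have h2 := antitone_dyadicSucc ht hkl
  have h3 := dyadicFloor_nonneg k t
  have h4 : dyadicSucc k t ^ (2 - α) ≤ dyadicSucc l t ^ (2 - α) :=
    Real.rpow_le_rpow_of_nonpos (dyadicSucc_pos l t) h2 (by linarith)
  have h5 : dyadicFloor k t ^ α ≤ dyadicFloor l t ^ α :=
    Real.rpow_le_rpow h3 h1 (by linarith)
  have h6 := Real.rpow_nonneg (dyadicSucc_pos k t).le (2 - α)
  have h7 := Real.rpow_nonneg (h3.trans h1) α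
  have h8 : 0 < α - 2 := by linarith
  have hpi := Real.pi_pos
  refine ENNReal.ofReal_le_ofReal (Real.exp_le_exp.2 ?_)
  gcongr

lemma iSup_outerMean {lam C α : ℝ} (hlam : 0 < lam) (hC : 0 ≤ C) (hα : 2 < α) {t : ℝ}
    (ht : 0 < t) :
    ⨆ k, outerMean lam C α (dyadicFloor k t) (dyadicSucc k t) =
      ENNReal.ofReal (Real.exp (lam * (2 * Real.pi * C * t ^ 2 / (α - 2)))) := by
  refine iSup_eq_of_tendsto (monotone_outerMean hlam hC hα ht.le) ?_
  have h2 : t ^ 2 = t ^ α * t ^ (2 - α) := by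
    rw [← Real.rpow_add ht, ← Real.rpow_natCast]; norm_num
  rw [h2, ← mul_assoc (2 * Real.pi * C)]
  refine ENNReal.tendsto_ofReal ((Real.continuous_exp.tendsto _).comp ?_)
  refine Filter.Tendsto.const_mul _ (Filter.Tendsto.div_const ?_ _)
  exact (((tendsto_dyadicFloor ht.le).rpow_const (Or.inl ht.ne')).const_mul _).mul
    ((tendsto_dyadicSucc ht.le).rpow_const (Or.inl ht.ne'))

/-- An integral over the cells of a partition by the values of a discrete function. -/
lemma MeasureTheory.lintegral_eq_tsum_indicator {Ω : Type*} [MeasurableSpace Ω] {μ : Measure Ω}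
    {f : Ω → ℕ} (hf : Measurable f) {G : ℕ → Ω → ℝ≥0∞} (hG : ∀ j, Measurable (G j)) :
    ∫⁻ ω, G (f ω) ω ∂μ = ∑' j, ∫⁻ ω, {ω | f ω = j}.indicator (G j) ω ∂μ := by
  have hm : ∀ j, MeasurableSet {ω | f ω = j} := fun j => hf (measurableSet_singleton j)
  rw [← lintegral_tsum fun j => ((hG j).indicator (hm j)).aemeasurable]
  refine lintegral_congr fun ω => ?_
  rw [tsum_eq_single (f ω)]
  · simp
  · intro j hj
    exact indicator_of_notMem (fun h => hj h.symm) _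

namespace IsHomogeneousPPP

variable {Ω : Type*} [MeasurableSpace Ω] {μ : Measure Ω} {X : ℕ → Ω → Plane} {lam C α : ℝ}

/-- Given that there is no point in the ball of radius `d`, the points outside the ball of radius
`b ≥ d` still form a Poisson process. -/
lemma lintegral_infProd_outerWeight (hlam : 0 < lam) (h : IsHomogeneousPPP μ lam.toNNReal X)
    (hC : 0 ≤ C) (hα : 2 < α) {a b d : ℝ} (ha : 0 ≤ a) (hb : 0 < b) (hd : d ≤ b) :
    ∫⁻ ω, {ω | d ≤ nearestDist fun n => X n ω}.indicator
        (fun ω => infProd fun n => outerWeight C α a b (X n ω)) ω ∂μ =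
      μ {ω | d ≤ nearestDist fun n => X n ω} * outerMean lam C α a b := by
  have h1 := h.lintegral_infProd (D := Metric.ball 0 d) measurableSet_ball Metric.isBounded_ball
    (measurable_outerWeight C α a b) fun x hx => by
      rw [outerWeight, if_neg]
      rw [mem_ball_zero_iff] at hx
      linarith
  rw [← h.measure_pointCount_eq_zero measurableSet_ball Metric.isBounded_ball] at h1
  simp only [pointCount_ball_eq_zero_iff] at h1
  have hnn : (lam.toNNReal : ℝ≥0∞) = ENNReal.ofReal lam := rfl
  have h2 : ennExp (lam.toNNReal * ∫⁻ x, outerWeight C α a b x) = outerMean lam C α a b := by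
    have hα' : 0 < α - 2 := by linarith
    unfold outerWeight outerMean
    rw [lintegral_rpow_norm_of_le ha hb hα hC, hnn, ← ENNReal.ofReal_mul hlam.le, ennExp_ofReal]
    positivity
  rw [h2] at h1
  rw [← h1]
  refine lintegral_congr fun ω => ?_
  simp [indicator_apply]

/-- Given that the nearest point is at distance between `a` and `b`, the points outside the ball of
radius `b` still form a Poisson process. -/
lemma lintegral_infProd_outerWeight_Ico [IsProbabilityMeasure μ] (hlam : 0 < lam)
    (h : IsHomogeneousPPP μ lam.toNNReal X)
    (hC : 0 ≤ C) (hα : 2 < α) {a b : ℝ} (ha : 0 ≤ a) (hab : a < b) :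
    ∫⁻ ω, {ω | (nearestDist fun n => X n ω) ∈ Ico a b}.indicator
        (fun ω => infProd fun n => outerWeight C α a b (X n ω)) ω ∂μ =
      μ {ω | (nearestDist fun n => X n ω) ∈ Ico a b} * outerMean lam C α a b := by
  have hX := h.measurable
  have hR : Measurable fun ω => nearestDist fun n => X n ω :=
    measurable_nearestDist.comp (measurable_pi_lambda _ hX)
  have hP : Measurable fun ω => infProd fun n => outerWeight C α a b (X n ω) :=
    Measurable.infProd fun n => (measurable_outerWeight C α a b).comp (hX n)
  have hb := ha.trans_lt hab
  -- The event is the difference of the events `a ≤ r₀` and `b ≤ r₀`.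
  have e1 := h.lintegral_infProd_outerWeight hlam hC hα ha hb hab.le
  have e2 := h.lintegral_infProd_outerWeight hlam hC hα ha hb le_rfl
  have hmI : MeasurableSet {ω | (nearestDist fun n => X n ω) ∈ Ico a b} := hR measurableSet_Ico
  have hmb : MeasurableSet {ω | b ≤ nearestDist fun n => X n ω} := hR measurableSet_Ici
  have hdisj : Disjoint {ω | (nearestDist fun n => X n ω) ∈ Ico a b}
      {ω | b ≤ nearestDist fun n => X n ω} :=
    Set.disjoint_left.2 fun ω hω hω' => hω.2.not_ge hω'
  have hunion : {ω | a ≤ nearestDist fun n => X n ω} =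
      {ω | (nearestDist fun n => X n ω) ∈ Ico a b} ∪ {ω | b ≤ nearestDist fun n => X n ω} := by
    ext ω
    simp only [mem_ofPred_eq, mem_union, mem_Ico]
    constructor
    · intro hω
      rcases lt_or_ge (nearestDist fun n => X n ω) b with h' | h'
      · exact Or.inl ⟨hω, h'⟩
      · exact Or.inr h'
    · rintro (hω | hω)
      · exact hω.1
      · exact hab.le.trans hω
  have hfin : μ {ω | b ≤ nearestDist fun n => X n ω} * outerMean lam C α a b ≠ ∞ :=
    ENNReal.mul_ne_top (measure_ne_top _ _) ENNReal.ofReal_ne_top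
  rw [hunion, measure_union hdisj hmb, add_mul, indicator_union_of_disjoint hdisj,
    lintegral_add_left (hP.indicator hmI), e2] at e1
  exact (ENNReal.add_left_inj hfin).1 e1

/-- On each dyadic cell of the nearest distance, the product over the points beyond the cell can be
replaced by its mean. -/
lemma lintegral_dyadic [IsProbabilityMeasure μ] (hlam : 0 < lam)
    (h : IsHomogeneousPPP μ lam.toNNReal X) (hC : 0 ≤ C) (hα : 2 < α) (F : ℝ → ℝ≥0∞) (k : ℕ) :
    ∫⁻ ω, F (dyadicFloor k (nearestDist fun n => X n ω)) *
        infProd (fun n => outerWeight C α (dyadicFloor k (nearestDist fun n => X n ω))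
          (dyadicSucc k (nearestDist fun n => X n ω)) (X n ω)) ∂μ =
      ∫⁻ ω, F (dyadicFloor k (nearestDist fun n => X n ω)) *
        outerMean lam C α (dyadicFloor k (nearestDist fun n => X n ω))
          (dyadicSucc k (nearestDist fun n => X n ω)) ∂μ := by
  have hX := h.measurable
  have hR : Measurable fun ω => nearestDist fun n => X n ω :=
    measurable_nearestDist.comp (measurable_pi_lambda _ hX)
  let a : ℕ → ℝ := fun j => j / 2 ^ k
  let b : ℕ → ℝ := fun j => (j + 1) / 2 ^ k
  have hf : Measurable fun ω => ⌊(nearestDist fun n => X n ω) * 2 ^ k⌋₊ :=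
    Nat.measurable_floor.comp (hR.mul_const _)
  have hP : ∀ j, Measurable fun ω => infProd fun n => outerWeight C α (a j) (b j) (X n ω) :=
    fun j => Measurable.infProd fun n => (measurable_outerWeight _ _ _ _).comp (hX n)
  refine (lintegral_eq_tsum_indicator hf
    (G := fun j ω => F (a j) * infProd fun n => outerWeight C α (a j) (b j) (X n ω))
    fun j => (hP j).const_mul _).trans ?_
  refine Eq.trans ?_ (lintegral_eq_tsum_indicator hf
    (G := fun j _ => F (a j) * outerMean lam C α (a j) (b j)) fun j => measurable_const).symm
  refine tsum_congr fun j => ?_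
  have hcell : {ω | ⌊(nearestDist fun n => X n ω) * 2 ^ k⌋₊ = j} =
      {ω | (nearestDist fun n => X n ω) ∈ Ico (a j) (b j)} := by
    ext ω
    have := nearestDist_nonneg fun n => X n ω
    simp only [mem_ofPred_eq, mem_Ico, a, b]
    rw [Nat.floor_eq_iff (by positivity), div_le_iff₀ (by positivity), lt_div_iff₀ (by positivity)]
  have hm : MeasurableSet {ω | (nearestDist fun n => X n ω) ∈ Ico (a j) (b j)} :=
    hR measurableSet_Ico
  have hab : a j < b j := by
    simp only [a, b]
    gcongr
    linarith
  have key := h.lintegral_infProd_outerWeight_Ico hlam hC hα (a := a j) (by positivity) hab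
  rw [hcell]
  simp_rw [indicator_const_mul]
  rw [lintegral_const_mul _ ((hP j).indicator hm), key, lintegral_const_mul _
    (measurable_const.indicator hm), lintegral_indicator_const hm, mul_comm (outerMean _ _ _ _ _)]

/-- Conditionally on the distance `r` to the nearest point, the farther points form a Poisson
process: the product over them averages to its Laplace functional. -/
lemma lintegral_infProd_strictOuterWeight [IsProbabilityMeasure μ] (hlam : 0 < lam)
    (h : IsHomogeneousPPP μ lam.toNNReal X) (hC : 0 ≤ C) (hα : 2 < α) {F : ℝ → ℝ≥0∞}
    (hF : LowerSemicontinuous F) (hFm : MonotoneOn F (Ici 0)) :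
    ∫⁻ ω, F (nearestDist fun n => X n ω) *
        infProd (fun n => strictOuterWeight C α (nearestDist fun n => X n ω) (X n ω)) ∂μ =
      ∫⁻ r, F r * ENNReal.ofReal (Real.exp (lam * (2 * Real.pi * C * r ^ 2 / (α - 2))))
        ∂nearestDistLaw lam := by
  have hα0 : 0 < α := by linarith
  have hX := h.measurable
  have hR : Measurable fun ω => nearestDist fun n => X n ω :=
    measurable_nearestDist.comp (measurable_pi_lambda _ hX)
  have hFmeas : Measurable F := hF.measurable
  have hFsup : ∀ t, 0 ≤ t → ⨆ k, F (dyadicFloor k t) = F t := by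
    intro t ht
    refine le_antisymm (iSup_le fun k => hFm (dyadicFloor_nonneg k t) ht (dyadicFloor_le k ht)) ?_
    refine le_of_forall_lt fun y hy => ?_
    obtain ⟨k, hk⟩ := ((tendsto_dyadicFloor ht).eventually (hF t y hy)).exists
    exact hk.trans_le (le_iSup (fun k => F (dyadicFloor k t)) k)
  have hFmono : ∀ t, 0 ≤ t → Monotone fun k => F (dyadicFloor k t) := fun t ht k l hkl =>
    hFm (dyadicFloor_nonneg k t) (dyadicFloor_nonneg l t) (monotone_dyadicFloor ht hkl)
  have hwm : ∀ t, 0 ≤ t → ∀ x : Plane,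
      Monotone fun k => outerWeight C α (dyadicFloor k t) (dyadicSucc k t) x := fun t ht x k l hkl =>
    outerWeight_mono hC hα0 (dyadicFloor_nonneg k t) (monotone_dyadicFloor ht hkl)
      (antitone_dyadicSucc ht hkl) x
  have hleft : ∀ ω, F (nearestDist fun n => X n ω) *
        infProd (fun n => strictOuterWeight C α (nearestDist fun n => X n ω) (X n ω)) =
      ⨆ k, F (dyadicFloor k (nearestDist fun n => X n ω)) *
        infProd (fun n => outerWeight C α (dyadicFloor k (nearestDist fun n => X n ω))
          (dyadicSucc k (nearestDist fun n => X n ω)) (X n ω)) := by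
    intro ω
    have ht := nearestDist_nonneg fun n => X n ω
    have hprod : Monotone fun k =>
        infProd fun n => outerWeight C α (dyadicFloor k (nearestDist fun n => X n ω))
          (dyadicSucc k (nearestDist fun n => X n ω)) (X n ω) :=
      fun k l hkl => infProd_mono fun n => hwm _ ht _ hkl
    rw [ENNReal.iSup_mul_iSup_of_monotone (hFmono _ ht) hprod, hFsup _ ht,
      ← infProd_iSup_of_monotone fun n => hwm _ ht _]
    simp_rw [iSup_outerWeight hC hα0 ht]
  have hright : ∀ r, 0 < r →
      F r * ENNReal.ofReal (Real.exp (lam * (2 * Real.pi * C * r ^ 2 / (α - 2)))) =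
      ⨆ k, F (dyadicFloor k r) * outerMean lam C α (dyadicFloor k r) (dyadicSucc k r) := by
    intro r hr
    rw [ENNReal.iSup_mul_iSup_of_monotone (hFmono _ hr.le) (monotone_outerMean hlam hC hα hr.le),
      hFsup _ hr.le, iSup_outerMean hlam hC hα hr]
  have hmean : ∀ k, Measurable fun r => outerMean lam C α (dyadicFloor k r) (dyadicSucc k r) := by
    intro k
    have := measurable_dyadicFloor k
    have := measurable_dyadicSucc k
    unfold outerMean
    fun_prop
  rw [lintegral_congr hleft, lintegral_congr_ae ((ae_nearestDistLaw_pos lam).mono hright),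
    lintegral_iSup, lintegral_iSup']
  · refine iSup_congr fun k => ?_
    rw [h.lintegral_dyadic hlam hC hα F k, ← h.map_nearestDist hlam, lintegral_map _ hR]
    exact (hFmeas.comp (measurable_dyadicFloor k)).mul (hmean k)
  · exact fun k => ((hFmeas.comp (measurable_dyadicFloor k)).mul (hmean k)).aemeasurable
  · filter_upwards [ae_nearestDistLaw_pos lam] with r hr k l hkl
    exact mul_le_mul' (hFmono r hr.le hkl) (monotone_outerMean hlam hC hα hr.le hkl)
  · intro k
    refine (hFmeas.comp ((measurable_dyadicFloor k).comp hR)).mul (Measurable.infProd fun n => ?_)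
    have h1 := (measurable_dyadicFloor k).comp hR
    have h2 := (measurable_dyadicSucc k).comp hR
    refine Measurable.ite (measurableSet_le h2 (hX n).norm) ?_ measurable_const
    exact (((h1.div (hX n).norm).pow_const α).const_mul C).ennreal_ofReal
  · exact fun k l hkl ω => mul_le_mul' (hFmono _ (nearestDist_nonneg _) hkl)
      (infProd_mono fun n => hwm _ (nearestDist_nonneg _) _ hkl)

end IsHomogeneousPPP

/-! ### The local delay -/

namespace NetworkParams

variable (p : NetworkParams)

lemma inv_coverageFactor_sinr (r : ℝ) : (ENNReal.ofReal (p.coverageFactor .sinr r))⁻¹ =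
    ENNReal.ofReal (Real.exp (p.γ * p.W * p.K * r ^ p.α / p.P)) := by
  rw [coverageFactor, Real.exp_neg, ENNReal.ofReal_inv_of_pos (Real.exp_pos _), inv_inv]

lemma inv_coverageFactor_sirAsnr (r : ℝ) : (ENNReal.ofReal (p.coverageFactor .sirAsnr r))⁻¹ =
    if r ≤ p.detectionRadius then 1 else ∞ := by
  by_cases h : r ≤ p.detectionRadius
  · rw [if_pos h, coverageFactor, indicator_of_mem (by exact h)]
    simp
  · rw [if_neg h, coverageFactor, indicator_of_notMem (by exact h)]
    simp

lemma noiseFactor_eq (c : CoverageCriterion) {r : ℝ} (hr : r ≠ p.detectionRadius) :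
    p.noiseFactor c r = (ENNReal.ofReal (p.coverageFactor c r))⁻¹ := by
  cases c with
  | sir => simp [noiseFactor, coverageFactor]
  | sinr => rw [inv_coverageFactor_sinr, noiseFactor]
  | sirAsnr => simp [inv_coverageFactor_sirAsnr, noiseFactor, hr.le_iff_lt]

lemma lowerSemicontinuous_inv_coverageFactor (c : CoverageCriterion) :
    LowerSemicontinuous fun r => (ENNReal.ofReal (p.coverageFactor c r))⁻¹ := by
  cases c with
  | sir => exact (continuous_const (y := (ENNReal.ofReal 1)⁻¹)).lowerSemicontinuous
  | sinr =>
    simp_rw [inv_coverageFactor_sinr]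
    refine (ENNReal.continuous_ofReal.comp (Real.continuous_exp.comp ?_)).lowerSemicontinuous
    exact (((Real.continuous_rpow_const p.α_pos.le)).const_mul _).div_const _
  | sirAsnr =>
    simp_rw [inv_coverageFactor_sirAsnr]
    intro r y hy
    by_cases h : r ≤ p.detectionRadius
    · simp only [if_pos h] at hy
      refine Filter.Eventually.of_forall fun t => hy.trans_le ?_
      beta_reduce
      split_ifs <;> simp
    · simp only [if_neg h] at hy
      filter_upwards [eventually_gt_nhds (not_le.1 h)] with t ht
      rwa [if_neg (not_le.2 ht)]

lemma monotoneOn_inv_coverageFactor (c : CoverageCriterion) :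
    MonotoneOn (fun r => (ENNReal.ofReal (p.coverageFactor c r))⁻¹) (Ici 0) := by
  have hγ := p.γ_pos
  have hW := p.W_pos
  have hK := p.K_pos
  have hP := p.P_pos
  have hα := p.α_pos
  intro r hr t ht hrt
  have hr : 0 ≤ r := hr
  cases c with
  | sir => exact le_rfl
  | sinr =>
    simp only [inv_coverageFactor_sinr]
    gcongr
  | sirAsnr =>
    simp only [inv_coverageFactor_sirAsnr]
    by_cases h : t ≤ p.detectionRadius
    · rw [if_pos h, if_pos (hrt.trans h)]
    · rw [if_neg h]
      exact le_top

lemma measurable_relInterference (n : ℕ) :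
    Measurable fun x : ℕ → Plane => p.relInterference (nearestDist x) (x n) := by
  have h1 := measurable_nearestDist
  have h2 : Measurable fun x : ℕ → Plane => ‖x n‖ := (measurable_pi_apply n).norm
  exact Measurable.ite (measurableSet_lt h1 h2)
    (((h1.div h2).pow_const p.α).const_mul p.γ).ennreal_ofReal measurable_const

lemma activeProb_mul_relInterference (a : ℝ) (x : Plane) :
    ENNReal.ofReal p.activeProb * p.relInterference a x =
      strictOuterWeight (p.activeProb * p.γ) p.α a x := by
  unfold relInterference strictOuterWeight
  split_ifs
  · rw [← ENNReal.ofReal_mul p.activeProb_nonneg, mul_assoc]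
  · rw [mul_zero]

namespace IsNetwork

variable {p} {Ω : Type*} [MeasurableSpace Ω] {μ : Measure Ω} {X : ℕ → Ω → Plane}
  {act : ℕ → Ω → Bool}

/-- Almost surely the inverse conditional coverage probability is the noise factor times the
product over the active base stations other than the nearest one. -/
lemma ae_inv_condCoverageProb [IsProbabilityMeasure μ] (h : p.IsNetwork μ X act)
    (c : CoverageCriterion) :
    ∀ᵐ ω ∂μ, (p.condCoverageProb c (fun n => X n ω) (fun n => act n ω))⁻¹ =
      (ENNReal.ofReal (p.coverageFactor c (nearestDist fun n => X n ω)))⁻¹ *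
        infProd fun n => if act n ω then
          p.relInterference (nearestDist fun n => X n ω) (X n ω) else 0 := by
  have hR : Measurable fun ω => nearestDist fun n => X n ω :=
    measurable_nearestDist.comp (measurable_pi_lambda _ h.isPPP.measurable)
  have hmap := h.isPPP.map_nearestDist p.lamBS_pos
  have hpos : ∀ᵐ ω ∂μ, 0 < nearestDist fun n => X n ω :=
    ae_of_ae_map hR.aemeasurable (hmap ▸ ae_nearestDistLaw_pos p.lamBS)
  have hrad : ∀ᵐ ω ∂μ, (nearestDist fun n => X n ω) ≠ p.detectionRadius :=
    ae_of_ae_map hR.aemeasurable (hmap ▸ ae_nearestDistLaw_ne p.lamBS p.detectionRadius)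
  filter_upwards [hpos, hrad, h.isPPP.ae_finite, h.isPPP.ae_norm_ne] with ω h1 h2 h3 h4
  obtain ⟨s, hs⟩ := exists_norm_eq_nearestDist h3
  rw [p.inv_condCoverageProb c _ (fun n => h1.trans_le (nearestDist_le _ n)) hs h4,
    p.noiseFactor_eq c h2]

end IsNetwork

end NetworkParams

theorem mainTheorem2 {Ω : Type*} [MeasurableSpace Ω] (μ : Measure Ω) [IsProbabilityMeasure μ]
    (p : NetworkParams) (c : CoverageCriterion) (X : ℕ → Ω → Plane) (act : ℕ → Ω → Bool)
    (hnet : p.IsNetwork μ X act) :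
    AEMeasurable
      (fun ω => (p.condCoverageProb c (fun n => X n ω) (fun n => act n ω))⁻¹) μ ∧
    p.localDelay c μ X act =
      ENNReal.ofReal (2 * Real.pi * p.lamBS) *
        ∫⁻ r₀ in Set.Ioi (0 : ℝ),
          ENNReal.ofReal
            (r₀ * Real.exp (-(Real.pi * p.lamBS * r₀ ^ 2 *
              (1 - 2 * p.γ * p.activeProb / (p.α - 2))))) /
            ENNReal.ofReal (p.coverageFactor c r₀) := by
  have hX : Measurable fun ω n => X n ω := measurable_pi_lambda _ hnet.isPPP.measurable
  have hF : Measurable fun r => (ENNReal.ofReal (p.coverageFactor c r))⁻¹ :=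
    (p.lowerSemicontinuous_inv_coverageFactor c).measurable
  have hae := hnet.ae_inv_condCoverageProb c
  refine ⟨AEMeasurable.congr (Measurable.aemeasurable ?_) (Filter.EventuallyEq.symm hae), ?_⟩
  · refine (hF.comp (measurable_nearestDist.comp hX)).mul (Measurable.infProd fun n => ?_)
    exact Measurable.ite (hnet.measurable_act n (measurableSet_singleton true))
      ((p.measurable_relInterference n).comp hX) measurable_const
  have hlam := p.lamBS_pos
  have hα : 0 < p.α - 2 := sub_pos.2 p.two_lt_α
  have hC : 0 ≤ p.activeProb * p.γ := mul_nonneg p.activeProb_nonneg p.γ_pos.le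
  have hdens : Measurable fun r : ℝ => ENNReal.ofReal
      (2 * Real.pi * p.lamBS * r * Real.exp (-(Real.pi * p.lamBS * r ^ 2))) := by fun_prop
  have hprod : Measurable fun r : ℝ => (ENNReal.ofReal (p.coverageFactor c r))⁻¹ * ENNReal.ofReal
      (Real.exp (p.lamBS * (2 * Real.pi * (p.activeProb * p.γ) * r ^ 2 / (p.α - 2)))) :=
    hF.mul (by fun_prop)
  rw [NetworkParams.localDelay, lintegral_congr_ae hae]
  refine (hnet.lintegral_infProd_act
    (G := fun x => (ENNReal.ofReal (p.coverageFactor c (nearestDist x)))⁻¹)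
    (z := fun n x => p.relInterference (nearestDist x) (x n))
    (hF.comp measurable_nearestDist) p.measurable_relInterference).trans ?_
  simp_rw [p.activeProb_mul_relInterference]
  rw [hnet.isPPP.lintegral_infProd_strictOuterWeight hlam hC p.two_lt_α
    (p.lowerSemicontinuous_inv_coverageFactor c) (p.monotoneOn_inv_coverageFactor c),
    nearestDistLaw, lintegral_withDensity_eq_lintegral_mul _ hdens hprod,
    ← lintegral_const_mul' _ _ ENNReal.ofReal_ne_top]
  refine setLIntegral_congr_fun measurableSet_Ioi fun r hr => ?_
  have hr : 0 < r := hr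
  simp only [Pi.mul_apply]
  rw [ENNReal.div_eq_inv_mul, mul_left_comm, mul_left_comm (ENNReal.ofReal (2 * Real.pi * p.lamBS)),
    ← ENNReal.ofReal_mul (by positivity), ← ENNReal.ofReal_mul (by positivity)]
  congr 2
  have hsplit : Real.exp (-(Real.pi * p.lamBS * r ^ 2 *
      (1 - 2 * p.γ * p.activeProb / (p.α - 2)))) =
      Real.exp (-(Real.pi * p.lamBS * r ^ 2)) * Real.exp (p.lamBS *
        (2 * Real.pi * (p.activeProb * p.γ) * r ^ 2 / (p.α - 2))) := by
    rw [← Real.exp_add]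
    congr 1
    ring
  rw [hsplit]
  ring
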